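/- Let $\mathbb{C}'=\{x+jy : x,y\in\mathbb{R}\}$, $j^2=1$, be the paracomplex numbers, and let $\mathbb{R}^3_1$ be $\mathbb{R}^3$ with $\langle x,y\rangle=-x_1y_1+x_2y_2+x_3y_3$. A Lorentz surface is a smooth surface whose coordinate changes are paraholomorphic in $z=x+jy$. Let $M$ be a simply connected Lorentz surface and $f\colon M\to\mathbb{R}^3_1$ a conformal timelike minimal surface; that is, $f$ is smooth, $\langle f_x,f_x\rangle=-\langle f_y,f_y\rangle$ and $\langle f_x,f_y\rangle=0$ in paraholomorphic coordinates, $f$ is immersed on an open dense set (singular points are allowed; regular surfaces are included), and its mean curvature vanishes at all points where it is immersed. Then there is a paraholomorphic $\Phi\colon M\to\mathbb{C}'^3$ with $f=\operatorname{Re}\Phi$. For a matrix $A\in\mathrm{CO}(1,2;\mathbb{C}')$, that is, ${}^tA\,I_{1,2}A=cI_{1,2}$ with $I_{1,2}=\mathrm{diag}(-1,1,1)$, $c\in\mathbb{C}'$ and $c\bar c\ne0$, write $f_A=\operatorname{Re}(A\Phi)$, which is determined up to a translation. Put $J=\mathrm{diag}(j,j,j)$, $D=\mathrm{diag}(j,1,1)$,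 $\hat f=f_J$ and $\hat f_D=f_{JD}=f_{DJ}$. For every choice of $\Phi$ and of the translations, the following four statements are equivalent. 1. $f$ has the line symmetry with respect to a timelike straight line on $f$ parallel to the $x_1$-axis. 2. $\hat f$ has the planar symmetry with respect to a spacelike plane parallel to the $x_2x_3$-plane which is perpendicular to $\hat f$. 3. $f_D$ has the point symmetry with respect to a shrinking singularity. 4. $\hat f_D$ has the folded symmetry with respect to a folding singularity. Here a symmetry of a surface $F\colon M\to\mathbb{R}^3_1$ is induced by an orientation reversing isometry $g$ of $M$, that is, a diffeomorphism $g\colon M\to M$ which is anti-paraholomorphic, preserves $\langle dF,dF\rangle$ and satisfies $F\circ g=OF+t$ for some $O\in\mathrm{O}(1,2)$, $t\in\mathbb{R}^3_1$. It is required to fix every point of a regular curve $\gamma\colon(a,b)\to M$, as follows. * (1) $F\circ\gamma$ is a regular curve in a line $L$ parallel to the $x_1$-axis, and $F\circ g=R\circ F$, where $R$ is the half-turn about $L$ with linear part $\mathrm{diag}(1,-1,-1)$. * (2) $F\circ\gamma$ lies in a plane $\Pi=\{x_1=s\}$, along $\gamma$ the map $F$ is immersed and its tangent plane contains the $x_1$-direction,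 and $F\circ g=R\circ F$, where $R$ is the reflection in $\Pi$. * (3) $F\circ\gamma$ is a single point $c$ (the shrinking singularity), every $\gamma(t)$ lies in the set $\mathcal A$ of points at which $F_x$ or $F_y$ is lightlike (nonzero and null), and $F\circ g=2c-F$. * (4) There is a paraholomorphic local coordinate $x+jy$ centred at a point $p\in\mathcal A$ with $F_y(x,0)\equiv0$, the curve is $\{y=0\}$ in this coordinate, and $F\circ g=F$. -/

import Mathlib

open scoped Manifold ContDiff Matrix

noncomputable section

/-! ### Paracomplex numbers and the paracomplex conformal group -/

/-- The paracomplex numbers `x + j y` with `j ^ 2 = 1`; `QuadraticAlgebra.norm z` is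
`z * conj z = x ^ 2 - y ^ 2`. -/
abbrev ParaC : Type := QuadraticAlgebra ℝ 1 0

/-- The paracomplex imaginary unit. -/
def paraUnit : ParaC := ⟨0, 1⟩

/-- Lorentz-Minkowski space with signature `(-, +, +)`. The coordinates `x_1, x_2, x_3` are
those with index `0, 1, 2`. -/
abbrev R31 : Type := Fin 3 → ℝ

/-- The Lorentz-Minkowski inner product. -/
def lorentzForm (x y : R31) : ℝ := -(x 0 * y 0) + x 1 * y 1 + x 2 * y 2

/-- A lightlike vector is a nonzero null vector. -/
def IsLightlike (x : R31) : Prop := x ≠ 0 ∧ lorentzForm x x = 0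

/-- `I_{1,2} = diag (-1, 1, 1)` over any ring. -/
def signMatrix (R : Type*) [Ring R] : Matrix (Fin 3) (Fin 3) R := Matrix.diagonal ![-1, 1, 1]

/-- The indefinite orthogonal group `O(1,2)`. -/
def indefiniteOrthogonal : Set (Matrix (Fin 3) (Fin 3) ℝ) :=
  {O | Oᵀ * signMatrix ℝ * O = signMatrix ℝ}

/-- The paracomplex conformal group `CO(1,2; ℂ')`. -/
def paraConformal : Set (Matrix (Fin 3) (Fin 3) ParaC) :=
  {A | ∃ c : ParaC, QuadraticAlgebra.norm c ≠ 0 ∧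
    Aᵀ * signMatrix ParaC * A = c • signMatrix ParaC}

/-- The matrix `J = diag (j, j, j)` of conjugation. -/
def matJ : Matrix (Fin 3) (Fin 3) ParaC := Matrix.diagonal ![paraUnit, paraUnit, paraUnit]

/-- The matrix `D = diag (j, 1, 1)` of duality. -/
def matD : Matrix (Fin 3) (Fin 3) ParaC := Matrix.diagonal ![paraUnit, 1, 1]

theorem paraUnit_mul_self : paraUnit * paraUnit = 1 := by
  ext <;> simp [paraUnit, QuadraticAlgebra.re_one, QuadraticAlgebra.im_one]

theorem matJ_mul_matD : matJ * matD = matD * matJ := by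
  simp only [matJ, matD, Matrix.diagonal_mul_diagonal, mul_comm]

theorem matJ_mem : matJ ∈ paraConformal := by
  refine ⟨1, by simp, ?_⟩
  rw [one_smul, matJ, signMatrix, Matrix.diagonal_transpose, Matrix.diagonal_mul_diagonal,
    Matrix.diagonal_mul_diagonal]
  congr 1
  funext i
  fin_cases i <;> simp [paraUnit_mul_self]

theorem matD_mem : matD ∈ paraConformal := by
  refine ⟨1, by simp, ?_⟩
  rw [one_smul, matD, signMatrix, Matrix.diagonal_transpose, Matrix.diagonal_mul_diagonal,
    Matrix.diagonal_mul_diagonal]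
  congr 1
  funext i
  fin_cases i <;> simp [paraUnit_mul_self]

/-! ### Lorentz surfaces -/

/-- Multiplication by `j` on the paracomplex plane `x + j y = (x, y)`. -/
def jMul : (ℝ × ℝ) →L[ℝ] (ℝ × ℝ) :=
  (ContinuousLinearMap.snd ℝ ℝ ℝ).prod (ContinuousLinearMap.fst ℝ ℝ ℝ)

/-- A Lorentz surface: a smooth surface whose coordinate changes are paraholomorphic, that is,
have derivatives commuting with `jMul`. The coordinates of a chart are `(x, y)`, `z = x + j y`.
Since coordinate changes commute with `jMul`, multiplication by `j` is well defined on each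
tangent space, and it is given by `jMul` in every chart. -/
class LorentzSurface (M : Type*) [TopologicalSpace M] [ChartedSpace (ℝ × ℝ) M] : Prop
    extends IsManifold 𝓘(ℝ, ℝ × ℝ) ∞ M where
  paraholomorphic_coordChange : ∀ e ∈ atlas (ℝ × ℝ) M, ∀ e' ∈ atlas (ℝ × ℝ) M,
    ∀ x ∈ (e.symm.trans e').source, ∀ v : ℝ × ℝ,
      fderiv ℝ (e.symm.trans e') x (jMul v) = jMul (fderiv ℝ (e.symm.trans e') x v)

section Surfaces

variable {M : Type*} [TopologicalSpace M] [ChartedSpace (ℝ × ℝ) M]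

/-- The differential of a map into Lorentz-Minkowski space. -/
def dSurf (f : M → R31) (p : M) : (ℝ × ℝ) →L[ℝ] R31 :=
  mfderiv 𝓘(ℝ, ℝ × ℝ) 𝓘(ℝ, R31) f p

/-- The differential of a self-map of the surface. -/
def dSelf (g : M → M) (p : M) : (ℝ × ℝ) →L[ℝ] (ℝ × ℝ) :=
  mfderiv 𝓘(ℝ, ℝ × ℝ) 𝓘(ℝ, ℝ × ℝ) g p

/-- The velocity of a curve in the surface. -/
def velocity (γ : ℝ → M) (t : ℝ) : ℝ × ℝ :=
  mfderiv 𝓘(ℝ, ℝ) 𝓘(ℝ, ℝ × ℝ) γ t (1 : ℝ)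

/-- The first fundamental form `⟨df, df⟩`. -/
def firstForm (f : M → R31) (p : M) (v w : ℝ × ℝ) : ℝ :=
  lorentzForm (dSurf f p v) (dSurf f p w)

/-- The map is immersed at the point. -/
def ImmersedAt (f : M → R31) (p : M) : Prop := Function.Injective (dSurf f p)

/-- The coordinate directions `∂_x` (index `0`) and `∂_y` (index `1`). -/
def coordDir : Fin 2 → ℝ × ℝ := ![(1, 0), (0, 1)]

/-- The matrix of the first fundamental form in the chart `e`. -/
def firstMatrix (e : OpenPartialHomeomorph M (ℝ × ℝ)) (f : M → R31) (p : M) :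
    Matrix (Fin 2) (Fin 2) ℝ :=
  Matrix.of fun i k => lorentzForm (fderiv ℝ (f ∘ e.symm) (e p) (coordDir i))
    (fderiv ℝ (f ∘ e.symm) (e p) (coordDir k))

/-- The matrix of the second fundamental form in the chart `e` with respect to the
normal vector `n`. -/
def secondMatrix (e : OpenPartialHomeomorph M (ℝ × ℝ)) (f : M → R31) (p : M) (n : R31) :
    Matrix (Fin 2) (Fin 2) ℝ :=
  Matrix.of fun i k => lorentzForm
    (fderiv ℝ (fun q => fderiv ℝ (f ∘ e.symm) q (coordDir k)) (e p) (coordDir i)) n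

/-- The mean curvature, half the trace of the shape operator `I⁻¹ II`. -/
def meanCurvature (e : OpenPartialHomeomorph M (ℝ × ℝ)) (f : M → R31) (p : M) (n : R31) : ℝ :=
  (1 / 2) * ((firstMatrix e f p)⁻¹ * secondMatrix e f p n).trace

/-- A unit normal vector of the surface at a point. -/
def IsUnitNormal (f : M → R31) (p : M) (n : R31) : Prop :=
  lorentzForm n n = 1 ∧ ∀ v, lorentzForm (dSurf f p v) n = 0

/-- Conformal timelike minimal surfaces. Singular points are allowed, but the surface is immersed
on a dense set. At an immersed point the second condition makes the induced metric
nondegenerate of signature `(1, 1)`, with the two null lines of the Lorentz surface. -/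
structure IsTimelikeMinimal (f : M → R31) : Prop where
  smooth : ContMDiff 𝓘(ℝ, ℝ × ℝ) 𝓘(ℝ, R31) ∞ f
  conformal : ∀ p v w, firstForm f p (jMul v) (jMul w) = -firstForm f p v w
  immersed : Dense {p | ImmersedAt f p}
  minimal : ∀ e ∈ atlas (ℝ × ℝ) M, ∀ p ∈ e.source, ImmersedAt f p →
    ∀ n, IsUnitNormal f p n → meanCurvature e f p n = 0

/-! ### Paraholomorphic lifts and Goursat transformations -/

/-- `Φ : M → ℂ'³` is paraholomorphic: writing `Φ = P + j Q`, the Cauchy-Riemann equations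
`Q_x = P_y`, `Q_y = P_x` hold. -/
def IsParaholomorphic (Φ : M → Fin 3 → ParaC) : Prop :=
  ContMDiff 𝓘(ℝ, ℝ × ℝ) 𝓘(ℝ, R31) ∞ (fun p i => (Φ p i).re) ∧
  ContMDiff 𝓘(ℝ, ℝ × ℝ) 𝓘(ℝ, R31) ∞ (fun p i => (Φ p i).im) ∧
  ∀ p v, dSurf (fun p i => (Φ p i).im) p v = dSurf (fun p i => (Φ p i).re) p (jMul v)

/-- `Φ` is a paraholomorphic map with `f = Re Φ`, that is, an integral `∫ ω` of the
paraholomorphic form `ω = df + j * df`. -/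
def IsParaholomorphicLift (f : M → R31) (Φ : M → Fin 3 → ParaC) : Prop :=
  IsParaholomorphic Φ ∧ ∀ p i, (Φ p i).re = f p i

/-- The surface `Re (A Φ)`, translated by `c`. If `f = Re Φ`, these are the Goursat transforms
`f_A` of `f`, with all choices of the base value. -/
def goursat (A : Matrix (Fin 3) (Fin 3) ParaC) (Φ : M → Fin 3 → ParaC) (c : R31) : M → R31 :=
  fun p i => ((A *ᵥ Φ p) i).re + c i

/-! ### Symmetries -/

/-- The diffeomorphism `g` is an orientation reversing element of the space group of `f`, with
linear part `O` and translation part `t`. Orientation reversing isometries of a Lorentzian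
plane are those that exchange the two null lines, that is, anticommute with `jMul`; where the
metric of `f` degenerates, the latter is what is required. -/
structure IsReversingSymmetry (f : M → R31)
    (g : Diffeomorph 𝓘(ℝ, ℝ × ℝ) 𝓘(ℝ, ℝ × ℝ) M M ∞)
    (O : Matrix (Fin 3) (Fin 3) ℝ) (t : R31) : Prop where
  reversing : ∀ p v, dSelf g p (jMul v) = -jMul (dSelf g p v)
  isometry : ∀ p v w, firstForm f (g p) (dSelf g p v) (dSelf g p w) = firstForm f p v w
  linear_mem : O ∈ indefiniteOrthogonal
  map_eq : ∀ p, f (g p) = O *ᵥ f p + t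

/-- A regular curve, defined on the open interval `(a, b)`. -/
def IsRegularCurve (γ : ℝ → M) (a b : ℝ) : Prop :=
  a < b ∧ ContMDiffOn 𝓘(ℝ, ℝ) 𝓘(ℝ, ℝ × ℝ) ∞ γ (Set.Ioo a b) ∧
    ∀ t ∈ Set.Ioo a b, velocity γ t ≠ 0

/-- The unit vector of the `x_1`-axis. -/
def axisDir : R31 := ![1, 0, 0]

/-- `f` has the line symmetry with respect to a timelike straight line on `f` parallel to the
`x_1`-axis: a segment of the line `c + ℝ e_1` is the image of a regular curve of points fixed by
`g`, and `g` induces the half-turn `x ↦ c + diag (1, -1, -1) (x - c)` about the line. -/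
def HasLineSymmetry (f : M → R31) : Prop :=
  ∃ (c : R31) (g : Diffeomorph 𝓘(ℝ, ℝ × ℝ) 𝓘(ℝ, ℝ × ℝ) M M ∞) (γ : ℝ → M) (a b : ℝ),
    IsReversingSymmetry f g (Matrix.diagonal ![1, -1, -1])
      (c - Matrix.diagonal ![1, -1, -1] *ᵥ c) ∧
    IsRegularCurve γ a b ∧
    ∀ t ∈ Set.Ioo a b, g (γ t) = γ t ∧ f (γ t) ∈ Set.range (fun s : ℝ => c + s • axisDir) ∧
      deriv (f ∘ γ) t ≠ 0

/-- `f` has the planar symmetry with respect to a (spacelike) plane `x_1 = s` perpendicular to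
`f`: along a regular curve of points fixed by `g`, the surface lies in the plane and its tangent
plane contains the normal of that plane, and `g` induces the reflection
`x ↦ diag (-1, 1, 1) x + 2 s e_1` in the plane. -/
def HasPlanarSymmetry (f : M → R31) : Prop :=
  ∃ (s : ℝ) (g : Diffeomorph 𝓘(ℝ, ℝ × ℝ) 𝓘(ℝ, ℝ × ℝ) M M ∞) (γ : ℝ → M) (a b : ℝ),
    IsReversingSymmetry f g (Matrix.diagonal ![-1, 1, 1]) ((2 * s) • axisDir) ∧
    IsRegularCurve γ a b ∧
    ∀ t ∈ Set.Ioo a b, g (γ t) = γ t ∧ f (γ t) 0 = s ∧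
      ImmersedAt f (γ t) ∧ ∃ v, dSurf f (γ t) v = axisDir

/-- The set of points where `f_x` or `f_y` is lightlike. For conformal `f` it does not depend on
the chart: there these are the points where the metric degenerates and `df` does not vanish. -/
def lightlikeSet (f : M → R31) : Set M :=
  {p | IsLightlike (dSurf f p (1, 0)) ∨ IsLightlike (dSurf f p (0, 1))}

/-- The points of the regular curve `γ` are shrinking singular points with the shrinking
singularity `c`. -/
def IsShrinkingCurve (f : M → R31) (γ : ℝ → M) (a b : ℝ) (c : R31) : Prop :=
  IsRegularCurve γ a b ∧ ∀ t ∈ Set.Ioo a b, γ t ∈ lightlikeSet f ∧ f (γ t) = c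

/-- `f` has the point symmetry with respect to a shrinking singularity `c`: the points of a
regular curve shrinking to `c` are fixed by `g`, and `g` induces `x ↦ 2 c - x`. -/
def HasPointSymmetry (f : M → R31) : Prop :=
  ∃ (c : R31) (g : Diffeomorph 𝓘(ℝ, ℝ × ℝ) 𝓘(ℝ, ℝ × ℝ) M M ∞) (γ : ℝ → M) (a b : ℝ),
    IsReversingSymmetry f g (-1) ((2 : ℝ) • c) ∧ IsShrinkingCurve f γ a b c ∧
    ∀ t ∈ Set.Ioo a b, g (γ t) = γ t

/-- A paraholomorphic local coordinate `z = x + j y` of the Lorentz surface. -/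
def IsParaCoordinate (e : OpenPartialHomeomorph M (ℝ × ℝ)) : Prop :=
  e ∈ IsManifold.maximalAtlas 𝓘(ℝ, ℝ × ℝ) ∞ M ∧
    ∀ e' ∈ atlas (ℝ × ℝ) M, ∀ x ∈ (e'.symm.trans e).source, ∀ v : ℝ × ℝ,
      fderiv ℝ (e'.symm.trans e) x (jMul v) = jMul (fderiv ℝ (e'.symm.trans e) x v)

/-- `p` is a folding singular point, with `e` as the local coordinate `(x, y)`, such that
`p = (0, 0)` and `f_y (x, 0) ≡ 0`. -/
def IsFoldingCoordinate (f : M → R31) (e : OpenPartialHomeomorph M (ℝ × ℝ)) (p : M) : Prop :=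
  IsParaCoordinate e ∧ p ∈ e.source ∧ e p = (0, 0) ∧ p ∈ lightlikeSet f ∧
    ∀ x : ℝ, (x, (0 : ℝ)) ∈ e.target → fderiv ℝ (f ∘ e.symm) (x, 0) (0, 1) = 0

/-- `f` has the folded symmetry with respect to a folding singularity: the points `(x, 0)` are
fixed by `g`, and `f ∘ g = f`. -/
def HasFoldedSymmetry (f : M → R31) : Prop :=
  ∃ (g : Diffeomorph 𝓘(ℝ, ℝ × ℝ) 𝓘(ℝ, ℝ × ℝ) M M ∞)
    (e : OpenPartialHomeomorph M (ℝ × ℝ)) (p : M),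
    IsReversingSymmetry f g 1 0 ∧ IsFoldingCoordinate f e p ∧
    ∀ x : ℝ, (x, (0 : ℝ)) ∈ e.target → g (e.symm (x, 0)) = e.symm (x, 0)

end Surfaces

end

/-!
Write `f = P` and `Φ = P + j Q`. The mean curvature of a conformal timelike surface vanishes at an
immersed point exactly when its coordinate functions satisfy the wave equation `f_xx = f_yy` there,
because `f_xx - f_yy` is always normal; as immersed points are dense, the equation holds everywhere
(`IsTimelikeMinimal.wave`). It says that the form `df ∘ j` is closed. On a simply connected surface
it is therefore exact, and a primitive `Q` gives the lift `Φ = f + j Q`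
(`IsTimelikeMinimal.exists_conjugate`). Exactness is proved with a covering: local primitives differ
by locally constant functions, hence glue to a bundle with discrete fibre, and the identity of the
surface lifts to it (`exists_sub_locally_constant`).

Since `dQ = dP ∘ j`, the four surfaces in the equivalence arise from `f` by replacing some
components by conjugate ones (`IsPartialConjugate`). An orientation reversing `g` anticommutes with
`j`, so `P_i ∘ g = ε P_i + const` and `Q_i ∘ g = -ε Q_i + const` are equivalent; this turns the
linear part `diag (1, -1, -1)` of the half-turn into `diag (-1, 1, 1)`, `-1` and `1`
(`IsPartialConjugate.isReversingSymmetry`), and a fixed point determines the translation part. All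
four statements are then compared with one infinitesimal condition, `HasAxisCurve`: along a regular
curve of fixed points with velocity `w`, the vector `df w` is a nonzero multiple of `e_1`. As
`g` fixes `w` and reverses `j w`, the vector `w` is not null, and conformality relates `df w` and
`df (j w)`. For the folded symmetry one also needs a paraholomorphic coordinate whose real axis is
the curve; it is found by reparametrizing the two null coordinates separately
(`exists_paraholomorphic_extension`).
-/

open scoped Topology

noncomputable section

/-! ### Paraholomorphic coordinates -/

@[simp] theorem jMul_apply (v : ℝ × ℝ) : jMul v = (v.2, v.1) := rfl

section Charts

variable {M : Type*} [TopologicalSpace M] [ChartedSpace (ℝ × ℝ) M]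

theorem isParaCoordinate_of_mem_atlas [LorentzSurface M] {e : OpenPartialHomeomorph M (ℝ × ℝ)}
    (he : e ∈ atlas (ℝ × ℝ) M) : IsParaCoordinate e :=
  ⟨IsManifold.subset_maximalAtlas he,
    fun e' he' => LorentzSurface.paraholomorphic_coordChange e' he' e he⟩

theorem IsParaCoordinate.mem_one [LorentzSurface M] {e : OpenPartialHomeomorph M (ℝ × ℝ)}
    (he : IsParaCoordinate e) : e ∈ IsManifold.maximalAtlas 𝓘(ℝ, ℝ × ℝ) 1 M :=
  IsManifold.maximalAtlas_subset_of_le (by simp) he.1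

/-- The derivative of the inverse of a paraholomorphic coordinate is an isomorphism onto the
tangent space which commutes with multiplication by `j`; it turns the differential of a map into
the derivative of its coordinate expression. -/
theorem IsParaCoordinate.exists_equiv [LorentzSurface M]
    {e : OpenPartialHomeomorph M (ℝ × ℝ)} (he : IsParaCoordinate e) {q : M} (hq : q ∈ e.source) :
    ∃ L : (ℝ × ℝ) ≃L[ℝ] (ℝ × ℝ),
      (L : (ℝ × ℝ) →L[ℝ] (ℝ × ℝ)) = mfderiv 𝓘(ℝ, ℝ × ℝ) 𝓘(ℝ, ℝ × ℝ) e.symm (e q) ∧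
      (∀ v, L (jMul v) = jMul (L v)) ∧
      ∀ f : M → R31, MDifferentiableAt 𝓘(ℝ, ℝ × ℝ) 𝓘(ℝ, R31) f q →
        ∀ v, fderiv ℝ (f ∘ e.symm) (e q) v = dSurf f q (L v) := by
  have hE : e.MDifferentiable 𝓘(ℝ, ℝ × ℝ) 𝓘(ℝ, ℝ × ℝ) :=
    ⟨fun x hx => (mdifferentiableAt_of_mem_maximalAtlas he.mem_one hx).mdifferentiableWithinAt,
     fun x hx => (mdifferentiableAt_symm_of_mem_maximalAtlas he.mem_one hx).mdifferentiableWithinAt⟩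
  let D : (ℝ × ℝ) ≃L[ℝ] (ℝ × ℝ) := hE.mfderiv hq
  have hD : ∀ v, D v = fderiv ℝ ((chartAt (ℝ × ℝ) q).symm.trans e) (chartAt (ℝ × ℝ) q q) v := by
    intro v
    have h1 : mfderiv 𝓘(ℝ, ℝ × ℝ) 𝓘(ℝ, ℝ × ℝ) e q =
        fderiv ℝ ((chartAt (ℝ × ℝ) q).symm.trans e) (chartAt (ℝ × ℝ) q q) := by
      refine (hE.mdifferentiableAt hq).mfderiv.trans ?_
      rw [ModelWithCorners.range_eq_univ, fderivWithin_univ]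
      rfl
    exact congrArg (fun T => T v) h1
  have hDj : ∀ v, D (jMul v) = jMul (D v) := by
    intro v
    rw [hD, hD]
    refine he.2 _ (chart_mem_atlas _ q) _ ?_ v
    simp [hq]
  have h3 : ∀ v, (D.symm v : ℝ × ℝ) =
      mfderiv 𝓘(ℝ, ℝ × ℝ) 𝓘(ℝ, ℝ × ℝ) e.symm (e q) v := by
    intro v
    apply D.injective
    rw [D.apply_symm_apply]
    have := congrArg (fun T => T v) (hE.comp_symm_deriv (e.map_source hq))
    rw [e.left_inv hq] at this
    exact this.symm
  refine ⟨D.symm, ContinuousLinearMap.ext h3, fun v => ?_, fun f hf v => ?_⟩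
  · apply D.injective
    rw [hDj, D.apply_symm_apply, D.apply_symm_apply]
  · have hf' : MDifferentiableAt 𝓘(ℝ, ℝ × ℝ) 𝓘(ℝ, R31) f (e.symm (e q)) := by
      rwa [e.left_inv hq]
    have h1 := mfderiv_comp (e q) hf' (hE.mdifferentiableAt_symm (e.map_source hq))
    rw [mfderiv_eq_fderiv] at h1
    refine (congrArg (fun T => T v) h1).trans ?_
    rw [h3, e.left_inv hq]
    rfl

theorem IsParaCoordinate.mdifferentiableAt_iff [LorentzSurface M]
    {e : OpenPartialHomeomorph M (ℝ × ℝ)} (he : IsParaCoordinate e) {q : M} (hq : q ∈ e.source)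
    {f : M → R31} : MDifferentiableAt 𝓘(ℝ, ℝ × ℝ) 𝓘(ℝ, R31) f q ↔
      DifferentiableAt ℝ (f ∘ e.symm) (e q) := by
  constructor
  · intro h
    rw [← mdifferentiableAt_iff_differentiableAt]
    refine MDifferentiableAt.comp _ ?_
      (mdifferentiableAt_symm_of_mem_maximalAtlas he.mem_one (e.map_source hq))
    rwa [e.left_inv hq]
  · intro h
    rw [← mdifferentiableAt_iff_differentiableAt] at h
    have := MDifferentiableAt.comp q h
      (mdifferentiableAt_of_mem_maximalAtlas he.mem_one hq)
    refine this.congr_of_eventuallyEq ?_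
    filter_upwards [e.open_source.mem_nhds hq] with x hx
    simp [e.left_inv hx]

/-- A map whose differential vanishes near a point is constant near that point. -/
theorem eventually_eq_of_dSurf_eq_zero [LorentzSurface M] {F : M → R31} {q : M}
    (h : ∀ᶠ x in 𝓝 q, MDifferentiableAt 𝓘(ℝ, ℝ × ℝ) 𝓘(ℝ, R31) F x ∧ ∀ v, dSurf F x v = 0) :
    ∀ᶠ x in 𝓝 q, F x = F q := by
  set e := chartAt (ℝ × ℝ) q with he
  have hq : q ∈ e.source := mem_chart_source _ q
  have hpe : IsParaCoordinate e := isParaCoordinate_of_mem_atlas (chart_mem_atlas _ q)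
  have h1 : ∀ᶠ y in 𝓝 (e q), y ∈ e.target ∧ (MDifferentiableAt 𝓘(ℝ, ℝ × ℝ) 𝓘(ℝ, R31) F (e.symm y)
      ∧ ∀ v, dSurf F (e.symm y) v = 0) := by
    refine (e.open_target.eventually_mem (e.map_source hq)).and ?_
    have := e.tendsto_symm hq
    exact this.eventually h
  obtain ⟨r, hr, hB⟩ := Metric.eventually_nhds_iff_ball.1 h1
  have hd : ∀ y ∈ Metric.ball (e q) r, DifferentiableAt ℝ (F ∘ e.symm) y ∧
      fderiv ℝ (F ∘ e.symm) y = 0 := by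
    intro y hy
    obtain ⟨hy1, hy2, hy3⟩ := hB y hy
    have hs := e.map_target hy1
    obtain ⟨L, -, -, hL⟩ := hpe.exists_equiv hs
    have e1 := e.right_inv hy1
    refine ⟨?_, ?_⟩
    · have := (hpe.mdifferentiableAt_iff hs).1 hy2
      rwa [e1] at this
    · refine ContinuousLinearMap.ext fun v => ?_
      have := hL F hy2 v
      rw [e1, hy3] at this
      simpa using this
  have hc : ∀ {x y}, x ∈ Metric.ball (e q) r → y ∈ Metric.ball (e q) r →
      (F ∘ e.symm) x = (F ∘ e.symm) y := Metric.isOpen_ball.is_const_of_fderiv_eq_zero (𝕜 := ℝ)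
    (convex_ball (e q) r).isPreconnected
    (fun y hy => (hd y hy).1.differentiableWithinAt) (fun y hy => (hd y hy).2)
  have hcont : ∀ᶠ x in 𝓝 q, e x ∈ Metric.ball (e q) r :=
    (e.continuousAt hq).eventually (Metric.ball_mem_nhds _ hr)
  filter_upwards [hcont, e.open_source.mem_nhds hq] with x hx hxs
  have := hc hx (Metric.mem_ball_self hr)
  simpa [e.left_inv hxs, e.left_inv hq] using this

end Charts

/-! ### Mean curvature and the wave equation -/

theorem lorentzForm_comm (x y : R31) : lorentzForm x y = lorentzForm y x := by
  simp only [lorentzForm]; ring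

theorem lorentzForm_add_left (x y z : R31) :
    lorentzForm (x + y) z = lorentzForm x z + lorentzForm y z := by
  simp only [lorentzForm, Pi.add_apply]; ring

theorem lorentzForm_smul_left (a : ℝ) (x y : R31) :
    lorentzForm (a • x) y = a * lorentzForm x y := by
  simp only [lorentzForm, Pi.smul_apply, smul_eq_mul]; ring

theorem lorentzForm_smul_right (a : ℝ) (x y : R31) :
    lorentzForm x (a • y) = a * lorentzForm x y := by
  simp only [lorentzForm, Pi.smul_apply, smul_eq_mul]; ring

/-- The Lorentz form is positive definite on the orthogonal complement of the `x_1`-axis. -/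
theorem eq_zero_of_lorentzForm_self {x : R31} (h0 : x 0 = 0) (h : lorentzForm x x = 0) : x = 0 := by
  simp only [lorentzForm, h0] at h
  funext i
  fin_cases i
  · exact h0
  · change x 1 = 0; nlinarith [sq_nonneg (x 1), sq_nonneg (x 2)]
  · change x 2 = 0; nlinarith [sq_nonneg (x 1), sq_nonneg (x 2)]

/-- Totally isotropic subspaces of Lorentz-Minkowski space are at most one-dimensional, so two
linearly independent orthogonal vectors of opposite norm are not null. -/
theorem lorentzForm_self_ne_zero {X Y : R31} (hXY : lorentzForm X Y = 0)
    (hYY : lorentzForm Y Y = -lorentzForm X X)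
    (hli : ∀ a b : ℝ, a • X + b • Y = 0 → a = 0 ∧ b = 0) : lorentzForm X X ≠ 0 := by
  intro h
  -- this combination is a null vector with vanishing time component
  have h1 : (Y 0) • X + (-X 0) • Y = 0 := by
    apply eq_zero_of_lorentzForm_self
    · simp; ring
    · simp only [lorentzForm, Pi.add_apply, Pi.smul_apply, smul_eq_mul] at *
      linear_combination (Y 0) ^ 2 * h + (X 0) ^ 2 * (hYY - h) - 2 * X 0 * Y 0 * hXY
  obtain ⟨-, h2⟩ := hli _ _ h1
  have h3 := eq_zero_of_lorentzForm_self (neg_eq_zero.1 h2) h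
  have := (hli 1 0 (by simp [h3])).1
  norm_num at this

/-- A vector orthogonal to a nondegenerate tangent plane and to its unit normal vanishes. -/
theorem eq_zero_of_orthogonal {X Y w : R31} (hXY : lorentzForm X Y = 0)
    (hYY : lorentzForm Y Y = -lorentzForm X X) (hX : lorentzForm X X ≠ 0)
    (hwX : lorentzForm w X = 0) (hwY : lorentzForm w Y = 0)
    (hn : ∀ n, lorentzForm n n = 1 → lorentzForm X n = 0 → lorentzForm Y n = 0 →
      lorentzForm w n = 0) : w = 0 := by
  -- the Lorentzian cross product of `X` and `Y`
  let N : R31 := ![-(X 1 * Y 2 - X 2 * Y 1), X 2 * Y 0 - X 0 * Y 2, X 0 * Y 1 - X 1 * Y 0]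
  have hN : lorentzForm N N = lorentzForm X X ^ 2 := by
    have : lorentzForm N N = lorentzForm X Y ^ 2 - lorentzForm X X * lorentzForm Y Y := by
      simp [lorentzForm, N]; ring
    rw [this, hXY, hYY]; ring
  have hwN : lorentzForm w N = 0 := by
    have := hn ((lorentzForm X X)⁻¹ • N)
      (by rw [lorentzForm_smul_left, lorentzForm_smul_right, hN]; field_simp)
      (by rw [lorentzForm_smul_right]; simp [lorentzForm, N]; right; ring)
      (by rw [lorentzForm_smul_right]; simp [lorentzForm, N]; right; ring)
    rw [lorentzForm_smul_right] at this
    exact (mul_eq_zero.1 this).resolve_left (inv_ne_zero hX)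
  -- Cramer's rule for the three equations satisfied by `w`
  have key : ∀ i, lorentzForm N N * w i = 0 := by
    intro i
    simp only [lorentzForm] at hwX hwY hwN
    simp only [lorentzForm, N, Matrix.cons_val_zero, Matrix.cons_val_one, Matrix.cons_val] at *
    fin_cases i
    · simp only [Fin.zero_eta, Fin.isValue]
      linear_combination -(Y 1 * (X 0 * Y 1 - X 1 * Y 0) - Y 2 * (X 2 * Y 0 - X 0 * Y 2)) * hwX
        - ((X 2 * Y 0 - X 0 * Y 2) * X 2 - (X 0 * Y 1 - X 1 * Y 0) * X 1) * hwY
        - ((X 1 * Y 2 - X 2 * Y 1)) * hwN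
    · simp only [Fin.mk_one, Fin.isValue]
      linear_combination -(Y 2 * (X 1 * Y 2 - X 2 * Y 1) + Y 0 * (X 0 * Y 1 - X 1 * Y 0)) * hwX
        - (-(X 0 * Y 1 - X 1 * Y 0) * X 0 - (X 1 * Y 2 - X 2 * Y 1) * X 2) * hwY
        - (-(X 2 * Y 0 - X 0 * Y 2)) * hwN
    · simp only [Fin.reduceFinMk, Fin.isValue]
      linear_combination -(-Y 0 * (X 2 * Y 0 - X 0 * Y 2) - Y 1 * (X 1 * Y 2 - X 2 * Y 1)) * hwX
        - ((X 1 * Y 2 - X 2 * Y 1) * X 1 + (X 2 * Y 0 - X 0 * Y 2) * X 0) * hwY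
        - (-(X 0 * Y 1 - X 1 * Y 0)) * hwN
  funext i
  have := key i
  rw [hN] at this
  exact (mul_eq_zero.1 this).resolve_left (pow_ne_zero 2 hX)

theorem fderiv_lorentzForm {A B : ℝ × ℝ → R31} {x : ℝ × ℝ} (hA : DifferentiableAt ℝ A x)
    (hB : DifferentiableAt ℝ B x) (v : ℝ × ℝ) :
    fderiv ℝ (fun q => lorentzForm (A q) (B q)) x v =
      lorentzForm (fderiv ℝ A x v) (B x) + lorentzForm (A x) (fderiv ℝ B x v) := by
  have hA' := hasFDerivAt_pi'.1 hA.hasFDerivAt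
  have hB' := hasFDerivAt_pi'.1 hB.hasFDerivAt
  have h := ((((hA' 0).mul (hB' 0)).neg).add ((hA' 1).mul (hB' 1))).add ((hA' 2).mul (hB' 2))
  have h' := congrArg (fun T => T v) h.fderiv
  refine Eq.trans ?_ (h'.trans ?_)
  · rfl
  · simp [lorentzForm]; ring

section Chart

variable {M : Type*} [TopologicalSpace M] [ChartedSpace (ℝ × ℝ) M]

theorem IsParaCoordinate.contDiffOn {e : OpenPartialHomeomorph M (ℝ × ℝ)} (he : IsParaCoordinate e)
    {f : M → R31} (hf : ContMDiff 𝓘(ℝ, ℝ × ℝ) 𝓘(ℝ, R31) ∞ f) :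
    ContDiffOn ℝ ∞ (f ∘ e.symm) e.target := by
  rw [← contMDiffOn_iff_contDiffOn]
  exact hf.comp_contMDiffOn (contMDiffOn_symm_of_mem_maximalAtlas he.1)

variable [LorentzSurface M]

/-- At an immersed point the vanishing of the mean curvature is the wave equation, because the
tangential part of `f_xx - f_yy` vanishes for every conformal map. -/
theorem IsTimelikeMinimal.wave_of_immersed {f : M → R31} (hf : IsTimelikeMinimal f)
    {e : OpenPartialHomeomorph M (ℝ × ℝ)} (he : e ∈ atlas (ℝ × ℝ) M) {x : ℝ × ℝ}
    (hx : x ∈ e.target) (hi : ImmersedAt f (e.symm x)) :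
    fderiv ℝ (fun q => fderiv ℝ (f ∘ e.symm) q (1, 0)) x (1, 0) =
      fderiv ℝ (fun q => fderiv ℝ (f ∘ e.symm) q (0, 1)) x (0, 1) := by
  have hpe := isParaCoordinate_of_mem_atlas he
  have hF : ContDiffAt ℝ ∞ (f ∘ e.symm) x :=
    (hpe.contDiffOn hf.smooth).contDiffAt (e.open_target.mem_nhds hx)
  have hdF : DifferentiableAt ℝ (fderiv ℝ (f ∘ e.symm)) x :=
    (hF.fderiv_right (m := 1) (by norm_cast)).differentiableAt (by simp)
  have hd : ∀ v, DifferentiableAt ℝ (fun q => fderiv ℝ (f ∘ e.symm) q v) x :=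
    fun v => hdF.clm_apply (differentiableAt_const v)
  have hsec : ∀ v w, fderiv ℝ (fun q => fderiv ℝ (f ∘ e.symm) q v) x w =
      fderiv ℝ (fderiv ℝ (f ∘ e.symm)) x w v := by
    intro v w
    rw [fderiv_clm_apply hdF (differentiableAt_const v)]
    simp
  have hsymm : ∀ v w, fderiv ℝ (fun q => fderiv ℝ (f ∘ e.symm) q v) x w =
      fderiv ℝ (fun q => fderiv ℝ (f ∘ e.symm) q w) x v := by
    intro v w
    rw [hsec, hsec]
    exact (hF.isSymmSndFDerivAt (by simp; norm_cast)).eq _ _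
  have hmd : ∀ p, MDifferentiableAt 𝓘(ℝ, ℝ × ℝ) 𝓘(ℝ, R31) f p :=
    fun p => hf.smooth.mdifferentiableAt (by simp)
  have hconf : ∀ q ∈ e.target, ∀ v w,
      lorentzForm (fderiv ℝ (f ∘ e.symm) q (jMul v)) (fderiv ℝ (f ∘ e.symm) q (jMul w)) =
        -lorentzForm (fderiv ℝ (f ∘ e.symm) q v) (fderiv ℝ (f ∘ e.symm) q w) := by
    intro q hq v w
    obtain ⟨L, -, hLj, hL⟩ := hpe.exists_equiv (e.map_target hq)
    have hL := hL f (hmd _)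
    rw [e.right_inv hq] at hL
    simp only [hL, hLj]
    exact hf.conformal _ _ _
  have hE : ∀ q ∈ e.target,
      lorentzForm (fderiv ℝ (f ∘ e.symm) q (0, 1)) (fderiv ℝ (f ∘ e.symm) q (0, 1)) =
        -lorentzForm (fderiv ℝ (f ∘ e.symm) q (1, 0)) (fderiv ℝ (f ∘ e.symm) q (1, 0)) :=
    fun q hq => hconf q hq (1, 0) (1, 0)
  have hO : ∀ q ∈ e.target,
      lorentzForm (fderiv ℝ (f ∘ e.symm) q (1, 0)) (fderiv ℝ (f ∘ e.symm) q (0, 1)) = 0 := by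
    intro q hq
    have h1 := hconf q hq (1, 0) (0, 1)
    have h2 := lorentzForm_comm (fderiv ℝ (f ∘ e.symm) q (1, 0)) (fderiv ℝ (f ∘ e.symm) q (0, 1))
    simp only [jMul_apply] at h1
    linarith
  have hnhds : e.target ∈ 𝓝 x := e.open_target.mem_nhds hx
  -- the derivatives of the two conformality relations `hE` and `hO`
  have hE' : ∀ v, lorentzForm (fderiv ℝ (fun q => fderiv ℝ (f ∘ e.symm) q (0, 1)) x v)
        (fderiv ℝ (f ∘ e.symm) x (0, 1)) =
      -lorentzForm (fderiv ℝ (fun q => fderiv ℝ (f ∘ e.symm) q (1, 0)) x v)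
        (fderiv ℝ (f ∘ e.symm) x (1, 0)) := by
    intro v
    have h : (fun q => lorentzForm (fderiv ℝ (f ∘ e.symm) q (0, 1))
        (fderiv ℝ (f ∘ e.symm) q (0, 1))) =ᶠ[𝓝 x] fun q =>
        -lorentzForm (fderiv ℝ (f ∘ e.symm) q (1, 0)) (fderiv ℝ (f ∘ e.symm) q (1, 0)) := by
      filter_upwards [hnhds] with q hq using hE q hq
    have h1 := congrArg (fun T : (ℝ × ℝ) →L[ℝ] ℝ => T v) h.fderiv_eq
    simp only [fderiv_fun_neg, neg_apply,
      fderiv_lorentzForm (hd _) (hd _)] at h1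
    rw [lorentzForm_comm (fderiv ℝ (f ∘ e.symm) x (0, 1)),
      lorentzForm_comm (fderiv ℝ (f ∘ e.symm) x (1, 0))] at h1
    linarith
  have hO' : ∀ v, lorentzForm (fderiv ℝ (fun q => fderiv ℝ (f ∘ e.symm) q (1, 0)) x v)
        (fderiv ℝ (f ∘ e.symm) x (0, 1)) +
      lorentzForm (fderiv ℝ (fun q => fderiv ℝ (f ∘ e.symm) q (0, 1)) x v)
        (fderiv ℝ (f ∘ e.symm) x (1, 0)) = 0 := by
    intro v
    have h : (fun q => lorentzForm (fderiv ℝ (f ∘ e.symm) q (1, 0))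
        (fderiv ℝ (f ∘ e.symm) q (0, 1))) =ᶠ[𝓝 x] fun q => (0 : ℝ) := by
      filter_upwards [hnhds] with q hq using hO q hq
    have h1 := congrArg (fun T : (ℝ × ℝ) →L[ℝ] ℝ => T v) h.fderiv_eq
    simp only [fderiv_lorentzForm (hd _) (hd _), fderiv_const_apply,
      zero_apply] at h1
    rwa [lorentzForm_comm (fderiv ℝ (f ∘ e.symm) x (1, 0))] at h1
  obtain ⟨L, -, hLj, hL⟩ := hpe.exists_equiv (e.map_target hx)
  have hL := hL f (hmd _)
  rw [e.right_inv hx] at hL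
  have hX := lorentzForm_self_ne_zero (hO x hx) (hE x hx) (by
    intro a b hab
    have h1 : dSurf f (e.symm x) (L (a, b)) = 0 := by
      rw [← hL, ← hab, ← map_smul, ← map_smul, ← map_add]
      simp
    have h2 := hi (h1.trans (map_zero (dSurf f (e.symm x))).symm)
    have h3 : ((a, b) : ℝ × ℝ) = 0 := by simpa using h2
    simpa using h3)
  rw [← sub_eq_zero]
  have sub_left : ∀ u v w, lorentzForm (u - v) w = lorentzForm u w - lorentzForm v w := by
    intro u v w; simp only [lorentzForm, Pi.sub_apply]; ring
  refine eq_zero_of_orthogonal (hO x hx) (hE x hx) hX ?_ ?_ ?_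
  -- the tangential components vanish by conformality and the symmetry of `f_xy`
  · rw [sub_left]
    have h1 := hE' (1, 0)
    have h2 := hO' (0, 1)
    rw [hsymm (1, 0) (0, 1)] at h2
    linarith
  · rw [sub_left]
    have h1 := hE' (0, 1)
    have h2 := hO' (1, 0)
    rw [hsymm (0, 1) (1, 0)] at h2
    linarith
  -- the normal component vanishes because `2 H = ⟨f_xx - f_yy, n⟩ / ⟨f_x, f_x⟩`
  · intro n hn1 hnX hnY
    have hmin := hf.minimal e he (e.symm x) (e.map_target hx) hi n ⟨hn1, fun v => by
      have h1 := hL (L.symm v)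
      rw [L.apply_symm_apply] at h1
      rw [← h1]
      obtain ⟨a, b⟩ := L.symm v
      have h2 : ((a, b) : ℝ × ℝ) = a • (1, 0) + b • (0, 1) := by simp
      rw [h2, map_add, map_smul, map_smul, lorentzForm_add_left, lorentzForm_smul_left,
        lorentzForm_smul_left, hnX, hnY]
      simp⟩
    have hfm : firstMatrix e f (e.symm x) = Matrix.diagonal
        ![lorentzForm (fderiv ℝ (f ∘ e.symm) x (1, 0)) (fderiv ℝ (f ∘ e.symm) x (1, 0)),
          -lorentzForm (fderiv ℝ (f ∘ e.symm) x (1, 0)) (fderiv ℝ (f ∘ e.symm) x (1, 0))] := by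
      ext i k
      fin_cases i <;> fin_cases k <;>
        simp [firstMatrix, coordDir, e.right_inv hx, hO x hx, hE x hx,
          lorentzForm_comm (fderiv ℝ (f ∘ e.symm) x (0, 1)) (fderiv ℝ (f ∘ e.symm) x (1, 0))]
    have hinv : (firstMatrix e f (e.symm x))⁻¹ = Matrix.diagonal
        ![(lorentzForm (fderiv ℝ (f ∘ e.symm) x (1, 0)) (fderiv ℝ (f ∘ e.symm) x (1, 0)))⁻¹,
          -(lorentzForm (fderiv ℝ (f ∘ e.symm) x (1, 0))
            (fderiv ℝ (f ∘ e.symm) x (1, 0)))⁻¹] := by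
      refine Matrix.inv_eq_right_inv ?_
      rw [hfm, Matrix.diagonal_mul_diagonal, ← Matrix.diagonal_one]
      congr 1
      funext i
      fin_cases i <;> simp [hX]
    rw [meanCurvature, hinv, Matrix.trace_fin_two] at hmin
    simp only [Matrix.diagonal_mul, secondMatrix, coordDir, e.right_inv hx, Matrix.of_apply,
      Matrix.cons_val_zero, Matrix.cons_val_one] at hmin
    rw [sub_left]
    field_simp at hmin
    linarith

end Chart

/-! ### Local conjugate surfaces -/

section Primitive

variable {M : Type*} [TopologicalSpace M] [ChartedSpace (ℝ × ℝ) M] [LorentzSurface M]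

/-- Coordinate functions of a timelike minimal surface satisfy the wave equation, also at singular
points, because immersed points are dense. -/
theorem IsTimelikeMinimal.wave {f : M → R31} (hf : IsTimelikeMinimal f)
    {e : OpenPartialHomeomorph M (ℝ × ℝ)} (he : e ∈ atlas (ℝ × ℝ) M) {x : ℝ × ℝ}
    (hx : x ∈ e.target) :
    fderiv ℝ (fderiv ℝ (f ∘ e.symm)) x (1, 0) (1, 0) =
      fderiv ℝ (fderiv ℝ (f ∘ e.symm)) x (0, 1) (0, 1) := by
  have hF := (isParaCoordinate_of_mem_atlas he).contDiffOn hf.smooth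
  have hd1 : ContDiffOn ℝ ∞ (fderiv ℝ (f ∘ e.symm)) e.target :=
    hF.fderiv_of_isOpen e.open_target (by simp)
  have hd2 : ContinuousOn (fderiv ℝ (fderiv ℝ (f ∘ e.symm))) e.target :=
    hd1.continuousOn_fderiv_of_isOpen e.open_target (by simp)
  have hsec : ∀ y ∈ e.target, ∀ v w, fderiv ℝ (fun q => fderiv ℝ (f ∘ e.symm) q v) y w =
      fderiv ℝ (fderiv ℝ (f ∘ e.symm)) y w v := by
    intro y hy v w
    rw [fderiv_clm_apply ((hd1.contDiffAt (e.open_target.mem_nhds hy)).differentiableAt (by simp))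
      (differentiableAt_const v)]
    simp
  rw [← sub_eq_zero]
  by_contra hne
  have hc : ContinuousAt (fun y => fderiv ℝ (fderiv ℝ (f ∘ e.symm)) y (1, 0) (1, 0) -
      fderiv ℝ (fderiv ℝ (f ∘ e.symm)) y (0, 1) (0, 1)) x := by
    have := hd2.continuousAt (e.open_target.mem_nhds hx)
    fun_prop
  have h1 := (hc.eventually_ne hne).and (e.open_target.mem_nhds hx)
  rw [← e.right_inv hx] at h1
  have h2 := (e.continuousAt (e.map_target hx)).eventually h1
  obtain ⟨p, hp, ⟨hp1, -⟩, hp2⟩ := hf.immersed.inter_nhds_nonempty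
    (h2.and (e.open_source.mem_nhds (e.map_target hx)))
  apply hp1
  have h3 := hf.wave_of_immersed he (e.map_source hp2) (by rwa [e.left_inv hp2])
  rw [hsec _ (e.map_source hp2), hsec _ (e.map_source hp2)] at h3
  exact sub_eq_zero.2 h3

/-- The wave equation says that `df ∘ j` is closed, so it has local primitives. -/
theorem IsTimelikeMinimal.exists_local_conjugate {f : M → R31} (hf : IsTimelikeMinimal f) (p : M) :
    ∃ (U : Set M) (h : M → R31), IsOpen U ∧ p ∈ U ∧ ∀ q ∈ U,
      ContMDiffAt 𝓘(ℝ, ℝ × ℝ) 𝓘(ℝ, R31) ∞ h q ∧ ∀ v, dSurf h q v = dSurf f q (jMul v) := by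
  set e := chartAt (ℝ × ℝ) p with he
  have hea := chart_mem_atlas (ℝ × ℝ) p
  have hp := mem_chart_source (ℝ × ℝ) p
  have hpe := isParaCoordinate_of_mem_atlas hea
  have hF := hpe.contDiffOn hf.smooth
  rw [← he] at hea hp hpe hF
  have hd1 : ContDiffOn ℝ ∞ (fderiv ℝ (f ∘ e.symm)) e.target :=
    hF.fderiv_of_isOpen e.open_target (by simp)
  obtain ⟨r, hr, hB⟩ := Metric.isOpen_iff.1 e.open_target (e p) (e.map_source hp)
  let α : ℝ × ℝ → (ℝ × ℝ) →L[ℝ] R31 := fun q => (fderiv ℝ (f ∘ e.symm) q).comp jMul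
  have hα : ContDiffOn ℝ ∞ α (Metric.ball (e p) r) :=
    (hd1.mono hB).clm_comp contDiffOn_const
  obtain ⟨H, hH⟩ := (convex_ball (e p) r).exists_forall_hasFDerivAt_of_fderiv_symmetric
    Metric.isOpen_ball (hα.differentiableOn (by simp)) (by
      intro a ha v w
      have hda : DifferentiableAt ℝ (fderiv ℝ (f ∘ e.symm)) a :=
        (hd1.contDiffAt (e.open_target.mem_nhds (hB ha))).differentiableAt (by simp)
      have hαa : ∀ v w, fderiv ℝ α a v w = fderiv ℝ (fderiv ℝ (f ∘ e.symm)) a v (jMul w) := by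
        intro v w
        simp only [α]
        rw [fderiv_clm_comp hda (differentiableAt_const _)]
        simp
      have hsymm := ((hF.contDiffAt (e.open_target.mem_nhds (hB ha))).isSymmSndFDerivAt
        (by simp; norm_cast)).eq (1, 0) (0, 1)
      have hw := hf.wave hea (hB ha)
      have hexp : ∀ u : ℝ × ℝ, u = u.1 • (1, 0) + u.2 • (0, 1) := fun u => by simp
      rw [hαa, hαa, jMul_apply, jMul_apply, hexp v, hexp w]
      simp only [Prod.smul_mk, Prod.mk_add_mk, smul_eq_mul, mul_one, mul_zero, add_zero, zero_add]
      rw [hexp (v.1, v.2), hexp (w.1, w.2), hexp (w.2, w.1), hexp (v.2, v.1)]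
      simp only [map_add, map_smul, add_apply, smul_apply,
        hsymm, hw]
      module)
  have hHs : ContDiffOn ℝ ∞ H (Metric.ball (e p) r) := by
    rw [contDiffOn_infty_iff_fderiv_of_isOpen Metric.isOpen_ball]
    exact ⟨fun x hx => (hH x hx).differentiableAt.differentiableWithinAt,
      hα.congr fun x hx => (hH x hx).fderiv⟩
  refine ⟨e.source ∩ e ⁻¹' Metric.ball (e p) r, H ∘ e,
    e.isOpen_inter_preimage Metric.isOpen_ball, ⟨hp, Metric.mem_ball_self hr⟩, ?_⟩
  rintro q ⟨hq, hqB⟩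
  have hsm : ContMDiffAt 𝓘(ℝ, ℝ × ℝ) 𝓘(ℝ, R31) ∞ (H ∘ e) q := by
    refine ContMDiffAt.comp q ?_ (contMDiffAt_of_mem_maximalAtlas hpe.1 hq)
    exact (hHs.contDiffAt (Metric.isOpen_ball.mem_nhds hqB)).contMDiffAt
  refine ⟨hsm, fun v => ?_⟩
  obtain ⟨L, -, hLj, hL⟩ := hpe.exists_equiv hq
  have h1 := hL (H ∘ e) (hsm.mdifferentiableAt (by simp)) (L.symm v)
  have h2 := hL f (hf.smooth.mdifferentiableAt (by simp)) (jMul (L.symm v))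
  rw [hLj, L.apply_symm_apply] at h2
  rw [L.apply_symm_apply] at h1
  rw [← h1, ← h2]
  have h3 : (H ∘ e) ∘ e.symm =ᶠ[𝓝 (e q)] H := by
    filter_upwards [e.open_target.mem_nhds (e.map_source hq)] with x hx
    simp [e.right_inv hx]
  rw [h3.fderiv_eq, (hH _ hqB).fderiv]
  rfl

end Primitive

/-! ### The conjugate surface and the paraholomorphic lift -/

/-- Local functions whose differences are locally constant can be glued, up to local constants, on
a simply connected space: they are the local trivializations of a bundle with discrete fibre,
that is, of a covering, which has a global section. -/
theorem exists_sub_locally_constant {X A : Type*} [TopologicalSpace X] [SimplyConnectedSpace X]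
    [LocallyPathConnectedSpace X] [AddCommGroup A] (U : X → Set X) (hUo : ∀ i, IsOpen (U i))
    (hU : ∀ i, i ∈ U i) (h : X → X → A)
    (hloc : ∀ i j, ∀ x ∈ U i ∩ U j, ∀ᶠ y in 𝓝 x, h i y - h j y = h i x - h j x) :
    ∃ Q : X → A, ∀ i, ∀ x ∈ U i, ∀ᶠ y in 𝓝 x, Q y - h i y = Q x - h i x := by
  let _ : TopologicalSpace A := ⊥
  have : DiscreteTopology A := ⟨rfl⟩
  -- the coordinate `v` over `U i` stands for the value `h i x + v` at `x` of a glued function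
  let Z : FiberBundleCore X X A :=
    { baseSet := U
      isOpen_baseSet := hUo
      indexAt := id
      mem_baseSet_at := hU
      coordChange := fun i j x v => v + (h i x - h j x)
      coordChange_self := by intros; simp
      continuousOn_coordChange := by
        rintro i j ⟨x, v⟩ ⟨hx, -⟩
        refine ContinuousAt.continuousWithinAt ?_
        refine continuousAt_snd.add ?_
        refine ContinuousAt.comp' (g := fun y => h i y - h j y) ?_ continuousAt_fst
        refine ContinuousAt.congr (f := fun _ => h i x - h j x) continuousAt_const ?_
        exact (hloc i j x hx).mono fun y hy => hy.symm
      coordChange_comp := by intros; abel }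
  have hcov : IsCoveringMap (Bundle.TotalSpace.proj : Bundle.TotalSpace A Z.Fiber → X) :=
    FiberBundle.isCoveringMap
  obtain ⟨x₀⟩ : Nonempty X := inferInstance
  obtain ⟨σ, ⟨-, hσ⟩, -⟩ := hcov.existsUnique_continuousMap_lifts (ContinuousMap.id X) x₀
    ⟨x₀, (0 : A)⟩ rfl
  have hσ' : ∀ x, (σ x).1 = x := fun x => congrFun hσ x
  let s : X → A := fun x => (σ x).2
  refine ⟨fun x => h x x + s x, fun i x hx => ?_⟩
  have hc : ContinuousAt (fun y => (Z.localTriv i (σ y)).2) x := by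
    refine continuousAt_snd.comp ?_
    refine ContinuousAt.comp ?_ σ.continuous.continuousAt
    refine (Z.localTriv i).toOpenPartialHomeomorph.continuousAt ?_
    change σ x ∈ (Z.localTriv i).source
    rw [Z.mem_localTriv_source, hσ']
    exact hx
  have hev : ∀ y, (Z.localTriv i (σ y)).2 = h y y + s y - h i y := by
    intro y
    rw [Z.localTriv_apply]
    change s y + (h (σ y).1 (σ y).1 - h i (σ y).1) = _
    rw [hσ']
    abel
  simp only [hev] at hc
  exact hc.eventually (isOpen_discrete {h x x + s x - h i x} |>.mem_nhds rfl)

section Conjugate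

variable {M : Type*} [TopologicalSpace M] [ChartedSpace (ℝ × ℝ) M]

theorem dSurf_add {F G : M → R31} {p : M} (hF : MDifferentiableAt 𝓘(ℝ, ℝ × ℝ) 𝓘(ℝ, R31) F p)
    (hG : MDifferentiableAt 𝓘(ℝ, ℝ × ℝ) 𝓘(ℝ, R31) G p) (v : ℝ × ℝ) :
    dSurf (fun x => F x + G x) p v = dSurf F p v + dSurf G p v :=
  congrArg (fun T => T v) (mfderiv_add hF hG)

theorem dSurf_clm_comp (T : R31 →L[ℝ] R31) {F : M → R31} {p : M}
    (hF : MDifferentiableAt 𝓘(ℝ, ℝ × ℝ) 𝓘(ℝ, R31) F p) (v : ℝ × ℝ) :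
    dSurf (fun x => T (F x)) p v = T (dSurf F p v) := by
  have h := mfderiv_comp p (T.mdifferentiableAt (x := F p)) hF
  rw [T.mfderiv_eq] at h
  exact congrArg (fun S => S v) h

theorem dSurf_const (c : R31) (p : M) (v : ℝ × ℝ) : dSurf (fun _ : M => c) p v = 0 := by
  have h := mfderiv_const (I := 𝓘(ℝ, ℝ × ℝ)) (I' := 𝓘(ℝ, R31)) (x := p) (c := c)
  exact congrArg (fun S => S v) h

theorem dSurf_congr {F G : M → R31} {p : M} (h : F =ᶠ[𝓝 p] G) (v : ℝ × ℝ) :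
    dSurf F p v = dSurf G p v :=
  congrArg (fun S : (ℝ × ℝ) →L[ℝ] R31 => S v) h.mfderiv_eq

theorem dSurf_sub {F G : M → R31} {p : M} (hF : MDifferentiableAt 𝓘(ℝ, ℝ × ℝ) 𝓘(ℝ, R31) F p)
    (hG : MDifferentiableAt 𝓘(ℝ, ℝ × ℝ) 𝓘(ℝ, R31) G p) (v : ℝ × ℝ) :
    dSurf (fun x => F x - G x) p v = dSurf F p v - dSurf G p v :=
  congrArg (fun T => T v) (mfderiv_sub hF hG)

/-- The conjugate surface: on a simply connected Lorentz surface the closed form `df ∘ j` is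
exact. -/
theorem IsTimelikeMinimal.exists_conjugate [LorentzSurface M] [SimplyConnectedSpace M] {f : M → R31}
    (hf : IsTimelikeMinimal f) : ∃ Q : M → R31, ContMDiff 𝓘(ℝ, ℝ × ℝ) 𝓘(ℝ, R31) ∞ Q ∧
      ∀ p v, dSurf Q p v = dSurf f p (jMul v) := by
  have := ChartedSpace.locallyPathConnectedSpace (ℝ × ℝ) M
  choose U h hUo hU hh using hf.exists_local_conjugate
  obtain ⟨Q, hQ⟩ := exists_sub_locally_constant U hUo hU h (by
    intro i j x hx
    refine eventually_eq_of_dSurf_eq_zero (F := fun y => h i y - h j y) ?_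
    filter_upwards [(hUo i).mem_nhds hx.1, (hUo j).mem_nhds hx.2] with y hi hj
    have h1 := (hh i y hi).1.mdifferentiableAt (by simp)
    have h2 := (hh j y hj).1.mdifferentiableAt (by simp)
    exact ⟨h1.sub h2, fun v => by rw [dSurf_sub h1 h2, (hh i y hi).2, (hh j y hj).2, sub_self]⟩)
  have hev : ∀ p, Q =ᶠ[𝓝 p] fun y => h p y + (Q p - h p p) := by
    intro p
    filter_upwards [hQ p p (hU p)] with y hy
    rw [← hy]; abel
  refine ⟨Q, fun p => ?_, fun p v => ?_⟩
  · exact ((hh p p (hU p)).1.add contMDiffAt_const).congr_of_eventuallyEq (hev p)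
  · rw [dSurf_congr (hev p), dSurf_add ((hh p p (hU p)).1.mdifferentiableAt (by simp))
      mdifferentiableAt_const, dSurf_const, (hh p p (hU p)).2, add_zero]

theorem IsTimelikeMinimal.exists_lift [LorentzSurface M] [SimplyConnectedSpace M] {f : M → R31}
    (hf : IsTimelikeMinimal f) : ∃ Φ : M → Fin 3 → ParaC, IsParaholomorphicLift f Φ := by
  obtain ⟨Q, hQ, hd⟩ := hf.exists_conjugate
  exact ⟨fun p i => ⟨f p i, Q p i⟩, ⟨hf.smooth, hQ, hd⟩, fun _ _ => rfl⟩

end Conjugate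

/-! ### Partially conjugate surfaces and their symmetries -/

section Symmetry

variable {M : Type*} [TopologicalSpace M] [ChartedSpace (ℝ × ℝ) M]

/-- A map with vanishing differential is constant on a connected surface. -/
theorem eq_of_dSurf_eq_zero [LorentzSurface M] [PreconnectedSpace M] {F : M → R31}
    (hF : MDifferentiable 𝓘(ℝ, ℝ × ℝ) 𝓘(ℝ, R31) F) (h : ∀ x v, dSurf F x v = 0) (p q : M) :
    F p = F q := by
  have hl : IsLocallyConstant F := (IsLocallyConstant.iff_eventually_eq F).2 fun x =>
    eventually_eq_of_dSurf_eq_zero (Filter.Eventually.of_forall fun y => ⟨hF y, h y⟩)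
  exact hl.apply_eq_of_preconnectedSpace p q

/-- The diagonal linear map with entries `o`. -/
def diagMap (o : R31) : R31 →L[ℝ] R31 :=
  ContinuousLinearMap.pi fun i => o i • ContinuousLinearMap.proj i

@[simp] theorem diagMap_apply (o x : R31) (i : Fin 3) : diagMap o x i = o i * x i := rfl

theorem diagonal_mulVec_eq (o x : R31) : Matrix.diagonal o *ᵥ x = diagMap o x := by
  funext i
  simp [Matrix.mulVec_diagonal]

theorem dSurf_comp_self {G : M → R31} {g : M → M} {p : M}
    (hG : MDifferentiableAt 𝓘(ℝ, ℝ × ℝ) 𝓘(ℝ, R31) G (g p))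
    (hg : MDifferentiableAt 𝓘(ℝ, ℝ × ℝ) 𝓘(ℝ, ℝ × ℝ) g p) (v : ℝ × ℝ) :
    dSurf (fun x => G (g x)) p v = dSurf G (g p) (dSelf g p v) :=
  congrArg (fun T : (ℝ × ℝ) →L[ℝ] R31 => T v) (mfderiv_comp p hG hg)

theorem hasDerivAt_comp_curve {G : M → R31} {γ : ℝ → M} {t : ℝ}
    (hG : MDifferentiableAt 𝓘(ℝ, ℝ × ℝ) 𝓘(ℝ, R31) G (γ t))
    (hγ : MDifferentiableAt 𝓘(ℝ, ℝ) 𝓘(ℝ, ℝ × ℝ) γ t) :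
    HasDerivAt (G ∘ γ) (dSurf G (γ t) (velocity γ t)) t := by
  let T : ℝ →L[ℝ] ℝ × ℝ := mfderiv 𝓘(ℝ, ℝ) 𝓘(ℝ, ℝ × ℝ) γ t
  have h : HasFDerivAt (G ∘ γ) ((dSurf G (γ t)).comp T) t :=
    hasMFDerivAt_iff_hasFDerivAt.1 (hG.hasMFDerivAt.comp t hγ.hasMFDerivAt)
  exact h.hasDerivAt

theorem IsRegularCurve.mdifferentiableAt {γ : ℝ → M} {a b : ℝ} (h : IsRegularCurve γ a b) {t : ℝ}
    (ht : t ∈ Set.Ioo a b) : MDifferentiableAt 𝓘(ℝ, ℝ) 𝓘(ℝ, ℝ × ℝ) γ t :=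
  (h.2.1.contMDiffAt (Ioo_mem_nhds ht.1 ht.2)).mdifferentiableAt (by simp)

theorem IsRegularCurve.mid_mem {γ : ℝ → M} {a b : ℝ} (h : IsRegularCurve γ a b) :
    (a + b) / 2 ∈ Set.Ioo a b := by
  have := h.1
  constructor <;> linarith

/-- Along a curve of fixed points the velocity is fixed by the differential. -/
theorem IsRegularCurve.dSelf_velocity {γ : ℝ → M} {a b : ℝ} (h : IsRegularCurve γ a b) {g : M → M}
    (hg : MDifferentiable 𝓘(ℝ, ℝ × ℝ) 𝓘(ℝ, ℝ × ℝ) g) (hfix : ∀ t ∈ Set.Ioo a b, g (γ t) = γ t)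
    {t : ℝ} (ht : t ∈ Set.Ioo a b) : dSelf g (γ t) (velocity γ t) = velocity γ t := by
  have hev : g ∘ γ =ᶠ[𝓝 t] γ := by
    filter_upwards [Ioo_mem_nhds ht.1 ht.2] with s hs using hfix s hs
  have h1 : mfderiv 𝓘(ℝ, ℝ) 𝓘(ℝ, ℝ × ℝ) (g ∘ γ) t = _ := hev.mfderiv_eq
  have h2 := mfderiv_comp t (hg (γ t)) (h.mdifferentiableAt ht)
  have h3 := congrArg (fun T : ℝ →L[ℝ] ℝ × ℝ => T 1) (h2.symm.trans h1)
  exact h3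

/-- A component whose derivative along a curve vanishes is constant along the curve. -/
theorem IsRegularCurve.apply_eq {γ : ℝ → M} {a b : ℝ} (h : IsRegularCurve γ a b) {G : M → R31}
    (hG : MDifferentiable 𝓘(ℝ, ℝ × ℝ) 𝓘(ℝ, R31) G) {i : Fin 3}
    (h0 : ∀ t ∈ Set.Ioo a b, dSurf G (γ t) (velocity γ t) i = 0) {s t : ℝ}
    (hs : s ∈ Set.Ioo a b) (ht : t ∈ Set.Ioo a b) : G (γ s) i = G (γ t) i := by
  have hd : ∀ t ∈ Set.Ioo a b, HasDerivAt (fun s => G (γ s) i) 0 t := by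
    intro t ht
    have h1 := hasDerivAt_pi.1 (hasDerivAt_comp_curve (hG (γ t)) (h.mdifferentiableAt ht)) i
    rw [h0 t ht] at h1
    exact h1
  exact isOpen_Ioo.is_const_of_deriv_eq_zero isPreconnected_Ioo
    (fun t ht => (hd t ht).differentiableAt.differentiableWithinAt) (fun t ht => (hd t ht).deriv)
    hs ht

/-- A component which is constant along a curve has vanishing derivative in its direction. -/
theorem IsRegularCurve.dSurf_apply_eq_zero {γ : ℝ → M} {a b : ℝ} (h : IsRegularCurve γ a b)
    {G : M → R31} (hG : MDifferentiable 𝓘(ℝ, ℝ × ℝ) 𝓘(ℝ, R31) G) {i : Fin 3} {c : ℝ}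
    (hc : ∀ t ∈ Set.Ioo a b, G (γ t) i = c) {t : ℝ} (ht : t ∈ Set.Ioo a b) :
    dSurf G (γ t) (velocity γ t) i = 0 := by
  have h1 := hasDerivAt_pi.1 (hasDerivAt_comp_curve (hG (γ t)) (h.mdifferentiableAt ht)) i
  refine h1.unique ((hasDerivAt_const t c).congr_of_eventuallyEq ?_)
  filter_upwards [Ioo_mem_nhds ht.1 ht.2] with s hs using hc s hs

theorem jMul_jMul (v : ℝ × ℝ) : jMul (jMul v) = v := rfl

/-- A vector fixed by a map that anticommutes with `j` does not lie on a null line. -/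
theorem sq_ne_sq_of_fixed {T : (ℝ × ℝ) →L[ℝ] (ℝ × ℝ)} (hT : ∀ v, T (jMul v) = -jMul (T v))
    {w : ℝ × ℝ} (hw : T w = w) (h0 : w ≠ 0) : w.1 ^ 2 ≠ w.2 ^ 2 := by
  intro h
  have h1 := hT w
  rw [hw] at h1
  rcases sq_eq_sq_iff_eq_or_eq_neg.1 h with h | h
  · have h2 : jMul w = w := by ext <;> simp [h]
    rw [h2, hw, self_eq_neg] at h1
    exact h0 h1
  · have h2 : jMul w = -w := by ext <;> simp [h]
    rw [h2, map_neg, hw, neg_neg, neg_eq_self] at h1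
    exact h0 h1

/-- Multiplication by `j` is an anti-isometry of the induced metric, which may degenerate. At the
other points the map is conformal. -/
def IsConformal (f : M → R31) : Prop :=
  ∀ p v w, firstForm f p (jMul v) (jMul w) = -firstForm f p v w

theorem IsConformal.orthogonal {f : M → R31} (hf : IsConformal f) (p : M) (v : ℝ × ℝ) :
    lorentzForm (dSurf f p v) (dSurf f p (jMul v)) = 0 := by
  have h1 := hf p v (jMul v)
  have h2 := lorentzForm_comm (dSurf f p v) (dSurf f p (jMul v))
  simp only [firstForm, jMul_jMul] at h1
  linarith

theorem IsConformal.self_jMul {f : M → R31} (hf : IsConformal f) (p : M) (v : ℝ × ℝ) :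
    lorentzForm (dSurf f p (jMul v)) (dSurf f p (jMul v)) =
      -lorentzForm (dSurf f p v) (dSurf f p v) := hf p v v

theorem dSurf_eq_smul_add_smul (f : M → R31) (p : M) (v : ℝ × ℝ) :
    dSurf f p v = v.1 • dSurf f p (1, 0) + v.2 • dSurf f p (0, 1) := by
  rw [← map_smul, ← map_smul, ← map_add]
  simp

/-- Where the differential of a conformal map has a kernel, its image is totally isotropic. -/
theorem IsConformal.lorentzForm_self_eq_zero {f : M → R31} (hf : IsConformal f) {p : M}
    {w : ℝ × ℝ} (hw : w ≠ 0) (h0 : dSurf f p w = 0) (u : ℝ × ℝ) :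
    lorentzForm (dSurf f p u) (dSurf f p u) = 0 := by
  have hE := hf.self_jMul p (1, 0)
  have hO := hf.orthogonal p (1, 0)
  simp only [jMul_apply] at hE hO
  have hform : ∀ v, lorentzForm (dSurf f p v) (dSurf f p v) =
      (v.1 ^ 2 - v.2 ^ 2) * lorentzForm (dSurf f p (1, 0)) (dSurf f p (1, 0)) := by
    intro v
    rw [dSurf_eq_smul_add_smul f p v]
    simp only [lorentzForm, Pi.add_apply, Pi.smul_apply, smul_eq_mul] at *
    linear_combination v.2 ^ 2 * hE + 2 * v.1 * v.2 * hO
  have h1 : w.1 • dSurf f p (1, 0) = (-w.2) • dSurf f p (0, 1) := by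
    rw [neg_smul, eq_neg_iff_add_eq_zero, ← dSurf_eq_smul_add_smul, h0]
  have h2 : w.1 ^ 2 * lorentzForm (dSurf f p (1, 0)) (dSurf f p (1, 0)) =
      w.2 ^ 2 * lorentzForm (dSurf f p (0, 1)) (dSurf f p (0, 1)) := by
    have := congrArg (fun x => lorentzForm x x) h1
    simp only [lorentzForm_smul_left, lorentzForm_smul_right] at this
    linear_combination this
  have h4 : (w.1 ^ 2 + w.2 ^ 2) * lorentzForm (dSurf f p (1, 0)) (dSurf f p (1, 0)) = 0 := by
    rw [hE] at h2; linarith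
  rw [hform, (mul_eq_zero.1 h4).resolve_left fun h5 => hw ?_, mul_zero]
  ext
  · simp only [Prod.fst_zero]; nlinarith [sq_nonneg w.1, sq_nonneg w.2]
  · simp only [Prod.snd_zero]; nlinarith [sq_nonneg w.1, sq_nonneg w.2]

/-- A point at which the differential of a conformal map has a kernel without vanishing belongs to
`lightlikeSet`. -/
theorem IsConformal.mem_lightlikeSet {f : M → R31} (hf : IsConformal f) {p : M} {w u : ℝ × ℝ}
    (hw : w ≠ 0) (h0 : dSurf f p w = 0) (hu : dSurf f p u ≠ 0) : p ∈ lightlikeSet f := by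
  have h := hf.lorentzForm_self_eq_zero hw h0
  by_cases hX : dSurf f p (1, 0) = 0
  · refine Or.inr ⟨fun hY => hu ?_, h _⟩
    rw [dSurf_eq_smul_add_smul, hX, hY]; simp
  · exact Or.inl ⟨hX, h _⟩

theorem ne_zero_of_mem_lightlikeSet {f : M → R31} {p : M} (h : p ∈ lightlikeSet f) :
    dSurf f p ≠ 0 := by
  intro h0
  rcases h with h | h
  · exact h.1 (by rw [h0]; rfl)
  · exact h.1 (by rw [h0]; rfl)

/-- A conformal map is immersed where the image of some direction is not null. -/
theorem IsConformal.immersedAt {f : M → R31} (hf : IsConformal f) {p : M} {w : ℝ × ℝ}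
    (h : lorentzForm (dSurf f p w) (dSurf f p w) ≠ 0) : ImmersedAt f p := by
  refine (injective_iff_map_eq_zero (dSurf f p)).2 fun v hv => ?_
  by_contra hv0
  exact h (hf.lorentzForm_self_eq_zero hv0 hv w)

/-- At a point where the image of `w` is a nonzero multiple of `e_1`, the image of `j w` is
orthogonal to it. -/
theorem IsConformal.jMul_apply_zero {f : M → R31} (hf : IsConformal f) {p : M} {w : ℝ × ℝ}
    (h1 : dSurf f p w 1 = 0) (h2 : dSurf f p w 2 = 0) (h0 : dSurf f p w 0 ≠ 0) :
    dSurf f p (jMul w) 0 = 0 := by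
  have h := hf.orthogonal p w
  simp only [lorentzForm, h1, h2] at h
  have : dSurf f p w 0 * dSurf f p (jMul w) 0 = 0 := by linarith
  exact (mul_eq_zero.1 this).resolve_left h0

theorem Diffeomorph.mdifferentiable_self
    (g : Diffeomorph 𝓘(ℝ, ℝ × ℝ) 𝓘(ℝ, ℝ × ℝ) M M ∞) :
    MDifferentiable 𝓘(ℝ, ℝ × ℝ) 𝓘(ℝ, ℝ × ℝ) g := g.contMDiff.mdifferentiable (by simp)

theorem IsReversingSymmetry.dSurf_dSelf {f : M → R31}
    {g : Diffeomorph 𝓘(ℝ, ℝ × ℝ) 𝓘(ℝ, ℝ × ℝ) M M ∞} {o t : R31}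
    (hs : IsReversingSymmetry f g (Matrix.diagonal o) t)
    (hf : MDifferentiable 𝓘(ℝ, ℝ × ℝ) 𝓘(ℝ, R31) f) (p : M) (v : ℝ × ℝ) :
    dSurf f (g p) (dSelf g p v) = diagMap o (dSurf f p v) := by
  rw [← dSurf_comp_self (hf _) (g.mdifferentiable_self p)]
  have h1 : (fun x => f (g x)) = fun x => diagMap o (f x) + t := by
    funext x
    rw [hs.map_eq, diagonal_mulVec_eq]
  have h2 : MDifferentiableAt 𝓘(ℝ, ℝ × ℝ) 𝓘(ℝ, R31) (fun x => diagMap o (f x)) p :=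
    (diagMap o).mdifferentiableAt.comp p (hf p)
  rw [h1, dSurf_add h2 mdifferentiableAt_const, dSurf_const, add_zero, dSurf_clm_comp _ (hf p)]

/-- The components of `G` with index in `σ` are conjugate to those of `f`, and the others agree
with those of `f` up to constants. The relation is symmetric in `f` and `G`, as `j ^ 2 = 1`. -/
structure IsPartialConjugate (σ : Fin 3 → Bool) (f G : M → R31) : Prop where
  smooth : ContMDiff 𝓘(ℝ, ℝ × ℝ) 𝓘(ℝ, R31) ∞ G
  dSurf_apply : ∀ p v i, dSurf G p v i = dSurf f p (if σ i then jMul v else v) i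

namespace IsPartialConjugate

variable {σ : Fin 3 → Bool} {f G : M → R31}

theorem mdifferentiable (h : IsPartialConjugate σ f G) :
    MDifferentiable 𝓘(ℝ, ℝ × ℝ) 𝓘(ℝ, R31) G := h.smooth.mdifferentiable (by simp)

theorem symm (h : IsPartialConjugate σ f G) (hf : ContMDiff 𝓘(ℝ, ℝ × ℝ) 𝓘(ℝ, R31) ∞ f) :
    IsPartialConjugate σ G f := by
  refine ⟨hf, fun p v i => ?_⟩
  rw [h.dSurf_apply]
  cases σ i <;> simp

/-- Conformality is an identity between products of single components which is invariant under
the exchange of the two terms that belong to a component. -/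
theorem isConformal (h : IsPartialConjugate σ f G) (hf : IsConformal f) : IsConformal G := by
  intro p v w
  have h1 := hf p v w
  simp only [firstForm, lorentzForm, h.dSurf_apply] at h1 ⊢
  cases σ 0 <;> cases σ 1 <;> cases σ 2 <;>
    simp only [if_true, jMul_jMul, Bool.false_eq_true, if_false] at h1 ⊢ <;> linarith

/-- Since `g` anticommutes with `j`, a reversing symmetry of `f` with diagonal linear part is one
of a partially conjugate surface, with the signs of the conjugate components changed. -/
theorem isReversingSymmetry [LorentzSurface M] [PreconnectedSpace M]
    (h : IsPartialConjugate σ f G) (hf : MDifferentiable 𝓘(ℝ, ℝ × ℝ) 𝓘(ℝ, R31) f)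
    {g : Diffeomorph 𝓘(ℝ, ℝ × ℝ) 𝓘(ℝ, ℝ × ℝ) M M ∞} {o o' t : R31}
    (hs : IsReversingSymmetry f g (Matrix.diagonal o) t)
    (ho : ∀ i, o' i = if σ i then -o i else o i) (ho' : ∀ i, o' i * o' i = 1)
    {x : M} (hx : g x = x) :
    IsReversingSymmetry G g (Matrix.diagonal o') (G x - Matrix.diagonal o' *ᵥ G x) := by
  have hg := g.mdifferentiable_self
  have hfd := hs.dSurf_dSelf hf
  have hGd : ∀ p v, dSurf G (g p) (dSelf g p v) = diagMap o' (dSurf G p v) := by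
    intro p v
    funext i
    rw [h.dSurf_apply, diagMap_apply, h.dSurf_apply, ho]
    have hr := hs.reversing p v
    cases σ i
    · simpa using congrFun (hfd p v) i
    · have h2 : jMul (dSelf g p v) = -dSelf g p (jMul v) := by rw [hr, neg_neg]
      have h3 := congrFun (hfd p (jMul v)) i
      simp only [if_true, h2, map_neg, Pi.neg_apply, h3, diagMap_apply, neg_mul]
  have hcomp : MDifferentiable 𝓘(ℝ, ℝ × ℝ) 𝓘(ℝ, R31) (fun y => G (g y)) :=
    h.mdifferentiable.comp hg
  have hdiag : MDifferentiable 𝓘(ℝ, ℝ × ℝ) 𝓘(ℝ, R31) (fun y => diagMap o' (G y)) :=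
    fun y => (diagMap o').mdifferentiableAt.comp y (h.mdifferentiable y)
  refine ⟨hs.reversing, fun p v w => ?_, ?_, fun p => ?_⟩
  · simp only [firstForm, hGd, lorentzForm, diagMap_apply]
    linear_combination -(dSurf G p v 0 * dSurf G p w 0) * ho' 0 +
      dSurf G p v 1 * dSurf G p w 1 * ho' 1 + dSurf G p v 2 * dSurf G p w 2 * ho' 2
  · rw [indefiniteOrthogonal, Set.mem_ofPred_eq, signMatrix, Matrix.diagonal_transpose,
      Matrix.diagonal_mul_diagonal, Matrix.diagonal_mul_diagonal]
    congr 1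
    funext i
    rw [mul_right_comm, ho', one_mul]
  · have hc := eq_of_dSurf_eq_zero (F := fun y => G (g y) - diagMap o' (G y))
      (hcomp.sub hdiag) (fun y v => by
        rw [dSurf_sub (hcomp y) (hdiag y), dSurf_comp_self (h.mdifferentiable _) (hg y), hGd,
          dSurf_clm_comp _ (h.mdifferentiable y), sub_self]) p x
    simp only [hx] at hc
    rw [diagonal_mulVec_eq, diagonal_mulVec_eq, ← hc]
    abel

end IsPartialConjugate

end Symmetry

/-! ### Line, planar and point symmetry -/

section Equivalence

variable {M : Type*} [TopologicalSpace M] [ChartedSpace (ℝ × ℝ) M]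

/-- Since `Re (j Φ) = Im Φ`, a diagonal Goursat transformation
with entries `j` and `1` replaces the components with entry `j` by conjugate ones. -/
theorem isPartialConjugate_goursat {f : M → R31} {Φ : M → Fin 3 → ParaC}
    (hΦ : IsParaholomorphicLift f Φ) {a : Fin 3 → ParaC} {σ : Fin 3 → Bool}
    (ha : ∀ i, a i = if σ i then paraUnit else 1) (c : R31) :
    IsPartialConjugate σ f (goursat (Matrix.diagonal a) Φ c) := by
  obtain ⟨⟨hP, hQ, hd⟩, hre⟩ := hΦ
  have hPf : (fun p i => (Φ p i).re) = f := by funext p i; exact hre p i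
  rw [hPf] at hP hd
  set Q : M → R31 := fun p i => (Φ p i).im with hQdef
  let o : R31 := fun i => if σ i then 0 else 1
  let o' : R31 := fun i => if σ i then 1 else 0
  have hG : goursat (Matrix.diagonal a) Φ c =
      fun p => (diagMap o (f p) + diagMap o' (Q p)) + c := by
    funext p i
    simp only [goursat, Matrix.mulVec_diagonal, ha, Pi.add_apply, diagMap_apply, o, o', hQdef,
      ← hre]
    cases σ i <;> simp [paraUnit]
  have h1 : ContMDiff 𝓘(ℝ, ℝ × ℝ) 𝓘(ℝ, R31) ∞ (fun p => diagMap o (f p)) :=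
    (diagMap o).contMDiff.comp hP
  have h2 : ContMDiff 𝓘(ℝ, ℝ × ℝ) 𝓘(ℝ, R31) ∞ (fun p => diagMap o' (Q p)) :=
    (diagMap o').contMDiff.comp hQ
  rw [hG]
  refine ⟨(h1.add h2).add contMDiff_const, fun p v i => ?_⟩
  have h3 : MDifferentiableAt 𝓘(ℝ, ℝ × ℝ) 𝓘(ℝ, R31)
      (fun p => diagMap o (f p) + diagMap o' (Q p)) p := (h1.add h2).mdifferentiableAt (by simp)
  rw [dSurf_add h3 mdifferentiableAt_const,
    dSurf_add (h1.mdifferentiableAt (by simp)) (h2.mdifferentiableAt (by simp)), dSurf_const,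
    dSurf_clm_comp _ (hP.mdifferentiableAt (by simp)),
    dSurf_clm_comp _ (hQ.mdifferentiableAt (by simp)), hd]
  simp only [Pi.add_apply, diagMap_apply, o, o', Pi.zero_apply, add_zero]
  cases σ i <;> simp

theorem isPartialConjugate_self {f : M → R31} (hf : ContMDiff 𝓘(ℝ, ℝ × ℝ) 𝓘(ℝ, R31) ∞ f) :
    IsPartialConjugate (fun _ => false) f f :=
  ⟨hf, fun _ _ _ => by simp⟩

/-- The infinitesimal form of the line symmetry, to which all four symmetries are reduced: along a
regular curve of fixed points of a reversing symmetry with linear part `diag (1, -1, -1)`, the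
derivative of `f` is a nonzero multiple of `e_1`. -/
def HasAxisCurve (f : M → R31) : Prop :=
  ∃ (t : R31) (g : Diffeomorph 𝓘(ℝ, ℝ × ℝ) 𝓘(ℝ, ℝ × ℝ) M M ∞) (γ : ℝ → M) (a b : ℝ),
    IsReversingSymmetry f g (Matrix.diagonal ![1, -1, -1]) t ∧ IsRegularCurve γ a b ∧
    (∀ s ∈ Set.Ioo a b, g (γ s) = γ s) ∧
    ∀ s ∈ Set.Ioo a b, dSurf f (γ s) (velocity γ s) 1 = 0 ∧
      dSurf f (γ s) (velocity γ s) 2 = 0 ∧ dSurf f (γ s) (velocity γ s) 0 ≠ 0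

theorem velocity_sq_ne_sq {γ : ℝ → M} {a b : ℝ} (hγ : IsRegularCurve γ a b)
    {g : Diffeomorph 𝓘(ℝ, ℝ × ℝ) 𝓘(ℝ, ℝ × ℝ) M M ∞}
    (hg : ∀ p v, dSelf g p (jMul v) = -jMul (dSelf g p v))
    (hfix : ∀ s ∈ Set.Ioo a b, g (γ s) = γ s) {t : ℝ} (ht : t ∈ Set.Ioo a b) :
    (velocity γ t).1 ^ 2 ≠ (velocity γ t).2 ^ 2 :=
  sq_ne_sq_of_fixed (hg (γ t)) (hγ.dSelf_velocity g.mdifferentiable_self hfix ht) (hγ.2.2 t ht)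

/-- If a direction is not null, it spans together with its multiple by `j`. -/
theorem eq_zero_of_apply_eq_zero {A : (ℝ × ℝ) →L[ℝ] R31} {w : ℝ × ℝ} (hw : w.1 ^ 2 ≠ w.2 ^ 2)
    (h1 : A w = 0) (h2 : A (jMul w) = 0) : A = 0 := by
  refine ContinuousLinearMap.ext fun v => ?_
  have hv : (w.1 ^ 2 - w.2 ^ 2) • v =
      (v.1 * w.1 - v.2 * w.2) • w + (v.2 * w.1 - v.1 * w.2) • jMul w := by
    ext <;> simp <;> ring
  have h3 := congrArg A hv
  rw [map_smul, map_add, map_smul, map_smul, h1, h2, smul_zero, smul_zero, add_zero] at h3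
  exact (smul_eq_zero.1 h3).resolve_left (sub_ne_zero.2 hw)

variable [LorentzSurface M] [PreconnectedSpace M] {f G : M → R31}

theorem hasLineSymmetry_iff_hasAxisCurve (hf : ContMDiff 𝓘(ℝ, ℝ × ℝ) 𝓘(ℝ, R31) ∞ f) :
    HasLineSymmetry f ↔ HasAxisCurve f := by
  have hfd : MDifferentiable 𝓘(ℝ, ℝ × ℝ) 𝓘(ℝ, R31) f := hf.mdifferentiable (by simp)
  constructor
  · rintro ⟨c, g, γ, a, b, hs, hγ, h⟩
    have hi : ∀ i : Fin 3, i ≠ 0 → ∀ t ∈ Set.Ioo a b, f (γ t) i = c i := by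
      intro i hi t ht
      obtain ⟨-, ⟨s, hs⟩, -⟩ := h t ht
      rw [← hs]
      fin_cases i
      · exact absurd rfl hi
      · simp [axisDir]
      · simp [axisDir]
    have h1 := fun t ht => hγ.dSurf_apply_eq_zero hfd (hi 1 (by decide)) (t := t) ht
    have h2 := fun t ht => hγ.dSurf_apply_eq_zero hfd (hi 2 (by decide)) (t := t) ht
    refine ⟨_, g, γ, a, b, hs, hγ, fun t ht => (h t ht).1, fun t ht =>
      ⟨h1 t ht, h2 t ht, fun h0 => (h t ht).2.2 ?_⟩⟩
    rw [(hasDerivAt_comp_curve (hfd _) (hγ.mdifferentiableAt ht)).deriv]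
    funext i
    fin_cases i
    · exact h0
    · exact h1 t ht
    · exact h2 t ht
  · rintro ⟨t, g, γ, a, b, hs, hγ, hfix, h⟩
    have hm := hγ.mid_mem
    refine ⟨f (γ ((a + b) / 2)), g, γ, a, b,
      (isPartialConjugate_self hf).isReversingSymmetry hfd hs (by simp)
        (by intro i; fin_cases i <;> simp) (hfix _ hm), hγ,
      fun t ht => ⟨hfix t ht, ?_, fun h0 => ?_⟩⟩
    · refine ⟨f (γ t) 0 - f (γ ((a + b) / 2)) 0, ?_⟩
      funext i
      fin_cases i
      · simp [axisDir]
      · simpa [axisDir] using hγ.apply_eq hfd (fun t ht => (h t ht).1) hm ht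
      · simpa [axisDir] using hγ.apply_eq hfd (fun t ht => (h t ht).2.1) hm ht
    · rw [(hasDerivAt_comp_curve (hfd _) (hγ.mdifferentiableAt ht)).deriv] at h0
      exact (h t ht).2.2 (congrFun h0 0)

/-- The planar symmetry of the conjugate surface. -/
theorem hasPlanarSymmetry_iff_hasAxisCurve (hf : ContMDiff 𝓘(ℝ, ℝ × ℝ) 𝓘(ℝ, R31) ∞ f)
    (hc : IsConformal f) (hG : IsPartialConjugate (fun _ => true) f G) :
    HasPlanarSymmetry G ↔ HasAxisCurve f := by
  have hfd : MDifferentiable 𝓘(ℝ, ℝ × ℝ) 𝓘(ℝ, R31) f := hf.mdifferentiable (by simp)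
  have hdG : ∀ p v, dSurf G p v = dSurf f p (jMul v) := fun p v => by
    funext i; simp [hG.dSurf_apply]
  constructor
  · rintro ⟨s, g, γ, a, b, hs, hγ, h⟩
    have hfix := fun t ht => (h t ht).1
    refine ⟨_, g, γ, a, b, (hG.symm hf).isReversingSymmetry hG.mdifferentiable hs
      (by intro i; fin_cases i <;> simp) (by intro i; fin_cases i <;> simp)
      (hfix _ hγ.mid_mem), hγ, hfix, fun t ht => ?_⟩
    -- `j γ'` is reversed by `g`, so that its image is normal to the plane
    have hd : -dSurf f (γ t) (velocity γ t) =
        diagMap ![-1, 1, 1] (dSurf f (γ t) (velocity γ t)) := by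
      have h1 := hs.dSurf_dSelf hG.mdifferentiable (γ t) (jMul (velocity γ t))
      rwa [hs.reversing, hγ.dSelf_velocity g.mdifferentiable_self hfix ht, hfix t ht, map_neg,
        hdG, jMul_jMul] at h1
    have h1 := congrFun hd 1
    have h2 := congrFun hd 2
    simp [neg_eq_self] at h1 h2
    refine ⟨h1, h2, fun h0 => hγ.2.2 t ht ?_⟩
    have h3 : dSurf G (γ t) (jMul (velocity γ t)) = dSurf G (γ t) 0 := by
      rw [hdG, jMul_jMul, map_zero]
      funext i
      fin_cases i
      exacts [h0, h1, h2]
    have h4 := congrArg jMul ((h t ht).2.2.1 h3)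
    rwa [jMul_jMul, map_zero] at h4
  · rintro ⟨t, g, γ, a, b, hs, hγ, hfix, h⟩
    have hm := hγ.mid_mem
    have hs' := hG.isReversingSymmetry (o' := ![-1, 1, 1]) hfd hs
      (by intro i; fin_cases i <;> simp) (by intro i; fin_cases i <;> simp) (hfix _ hm)
    have hj := fun t ht => hc.jMul_apply_zero (h t ht).1 (h t ht).2.1 (h t ht).2.2
    refine ⟨G (γ ((a + b) / 2)) 0, g, γ, a, b, ?_, hγ, fun t ht => ⟨hfix t ht, ?_, ?_,
      (dSurf f (γ t) (velocity γ t) 0)⁻¹ • jMul (velocity γ t), ?_⟩⟩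
    · convert hs' using 1
      funext i
      fin_cases i <;> simp [axisDir, Matrix.mulVec_diagonal]
      ring
    · refine hγ.apply_eq hG.mdifferentiable (fun t ht => ?_) ht hm
      rw [hdG]
      exact hj t ht
    · refine (hG.isConformal hc).immersedAt (w := jMul (velocity γ t)) ?_
      rw [hdG, jMul_jMul]
      simp [lorentzForm, (h t ht).1, (h t ht).2.1, (h t ht).2.2]
    · rw [map_smul, hdG, jMul_jMul]
      funext i
      fin_cases i
      · simp [axisDir, (h t ht).2.2]
      · simp [axisDir, (h t ht).1]
      · simp [axisDir, (h t ht).2.1]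

/-- The point symmetry of the dual surface, whose first component is conjugate to that of `f`. -/
theorem hasPointSymmetry_iff_hasAxisCurve (hf : ContMDiff 𝓘(ℝ, ℝ × ℝ) 𝓘(ℝ, R31) ∞ f)
    (hc : IsConformal f) (hG : IsPartialConjugate ![true, false, false] f G) :
    HasPointSymmetry G ↔ HasAxisCurve f := by
  have hfd : MDifferentiable 𝓘(ℝ, ℝ × ℝ) 𝓘(ℝ, R31) f := hf.mdifferentiable (by simp)
  have hd0 : ∀ p v, dSurf G p v 0 = dSurf f p (jMul v) 0 := fun p v => by simp [hG.dSurf_apply]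
  have hd1 : ∀ p v, dSurf G p v 1 = dSurf f p v 1 := fun p v => by simp [hG.dSurf_apply]
  have hd2 : ∀ p v, dSurf G p v 2 = dSurf f p v 2 := fun p v => by simp [hG.dSurf_apply]
  have hneg : (-1 : Matrix (Fin 3) (Fin 3) ℝ) = Matrix.diagonal ![-1, -1, -1] := by
    ext i k; fin_cases i <;> fin_cases k <;> simp
  constructor
  · rintro ⟨c, g, γ, a, b, hs, ⟨hγ, hcl⟩, hfix⟩
    rw [hneg] at hs
    refine ⟨_, g, γ, a, b, (hG.symm hf).isReversingSymmetry hG.mdifferentiable hs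
      (by intro i; fin_cases i <;> simp) (by intro i; fin_cases i <;> simp)
      (hfix _ hγ.mid_mem), hγ, hfix, fun t ht => ?_⟩
    have h0 : ∀ i, dSurf G (γ t) (velocity γ t) i = 0 := fun i =>
      hγ.dSurf_apply_eq_zero hG.mdifferentiable (c := c i)
        (fun t ht => congrFun (hcl t ht).2 i) ht
    have h1 := h0 1
    have h2 := h0 2
    have h3 := h0 0
    rw [hd1] at h1
    rw [hd2] at h2
    rw [hd0] at h3
    refine ⟨h1, h2, fun h4 => ne_zero_of_mem_lightlikeSet (hcl t ht).1 ?_⟩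
    -- otherwise `df` vanishes on `γ'`, hence also on `j γ'`, whose image is null
    have h5 : dSurf f (γ t) (velocity γ t) = 0 := by
      funext i
      fin_cases i
      exacts [h4, h1, h2]
    have h6 : dSurf f (γ t) (jMul (velocity γ t)) = 0 :=
      eq_zero_of_lorentzForm_self h3 (hc.lorentzForm_self_eq_zero (hγ.2.2 t ht) h5 _)
    have h7 := eq_zero_of_apply_eq_zero (velocity_sq_ne_sq hγ hs.reversing hfix ht) h5 h6
    refine ContinuousLinearMap.ext fun v => ?_
    funext i
    rw [hG.dSurf_apply, h7]
    rfl
  · rintro ⟨t, g, γ, a, b, hs, hγ, hfix, h⟩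
    have hm := hγ.mid_mem
    have hs' := hG.isReversingSymmetry (o' := ![-1, -1, -1]) hfd hs
      (by intro i; fin_cases i <;> simp) (by intro i; fin_cases i <;> simp) (hfix _ hm)
    have hz : ∀ t ∈ Set.Ioo a b, ∀ i, dSurf G (γ t) (velocity γ t) i = 0 := by
      intro t ht i
      fin_cases i
      · exact (hd0 _ _).trans (hc.jMul_apply_zero (h t ht).1 (h t ht).2.1 (h t ht).2.2)
      · exact (hd1 _ _).trans (h t ht).1
      · exact (hd2 _ _).trans (h t ht).2.1
    refine ⟨G (γ ((a + b) / 2)), g, γ, a, b, ?_, ⟨hγ, fun t ht => ⟨?_, ?_⟩⟩, hfix⟩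
    · rw [hneg]
      convert hs' using 1
      rw [← hneg, Matrix.neg_mulVec, Matrix.one_mulVec, two_smul, sub_neg_eq_add]
    · refine (hG.isConformal hc).mem_lightlikeSet (u := jMul (velocity γ t)) (hγ.2.2 t ht)
        (funext (hz t ht)) fun h0 => (h t ht).2.2 ?_
      have h1 := congrFun h0 0
      rwa [hd0, jMul_jMul] at h1
    · funext i
      exact hγ.apply_eq hG.mdifferentiable (fun t ht => hz t ht i) ht hm

end Equivalence

/-! ### Adapted coordinates and the folded symmetry -/

/-- The linear map `(x, y) ↦ (X, Y)` which multiplies the null coordinates `x + y`, `x - y` by `a`,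
`b`; these are the linear maps commuting with `jMul`. -/
def nullScale (a b : ℝ) : (ℝ × ℝ) →L[ℝ] (ℝ × ℝ) :=
  LinearMap.toContinuousLinearMap
    { toFun := fun v => ((a * (v.1 + v.2) + b * (v.1 - v.2)) / 2,
        (a * (v.1 + v.2) - b * (v.1 - v.2)) / 2)
      map_add' := fun v w => by ext <;> simp <;> ring
      map_smul' := fun r v => by ext <;> simp <;> ring }

theorem nullScale_apply (a b : ℝ) (v : ℝ × ℝ) : nullScale a b v =
    ((a * (v.1 + v.2) + b * (v.1 - v.2)) / 2, (a * (v.1 + v.2) - b * (v.1 - v.2)) / 2) := rfl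

theorem nullScale_jMul (a b : ℝ) (v : ℝ × ℝ) :
    nullScale a b (jMul v) = jMul (nullScale a b v) := by
  ext <;> simp [nullScale_apply] <;> ring

theorem nullScale_nullScale {a b : ℝ} (ha : a ≠ 0) (hb : b ≠ 0) (v : ℝ × ℝ) :
    nullScale a b (nullScale a⁻¹ b⁻¹ v) = v := by
  ext <;> simp only [nullScale_apply] <;> field_simp <;> ring

/-- The equivalence `nullScale a b` for nonzero `a`, `b`. -/
def nullScaleEquiv {a b : ℝ} (ha : a ≠ 0) (hb : b ≠ 0) : (ℝ × ℝ) ≃L[ℝ] (ℝ × ℝ) :=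
  ContinuousLinearEquiv.equivOfInverse (nullScale a b) (nullScale a⁻¹ b⁻¹)
    (fun v => by simpa using nullScale_nullScale (inv_ne_zero ha) (inv_ne_zero hb) v)
    (nullScale_nullScale ha hb)

/-- A curve in the paracomplex plane whose velocity is nowhere null extends from the real axis to
a paraholomorphic change of coordinates: each null coordinate of the curve is a function of the
parameter with nonvanishing derivative, which is applied to the corresponding null coordinate. -/
theorem exists_paraholomorphic_extension {c : ℝ → ℝ × ℝ} {ε : ℝ} (hε : 0 < ε)
    (hc : ContDiffOn ℝ ∞ c (Set.Ioo (-ε) ε))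
    (h0 : ∀ x ∈ Set.Ioo (-ε) ε, (deriv c x).1 ^ 2 ≠ (deriv c x).2 ^ 2) :
    ∃ E : OpenPartialHomeomorph (ℝ × ℝ) (ℝ × ℝ), (0, 0) ∈ E.source ∧
      ContDiffOn ℝ ∞ E E.source ∧ ContDiffOn ℝ ∞ E.symm E.target ∧
      (∀ z ∈ E.target, ∀ v, fderiv ℝ E.symm z (jMul v) = jMul (fderiv ℝ E.symm z v)) ∧
      ∀ x : ℝ, (x, (0 : ℝ)) ∈ E.source → x ∈ Set.Ioo (-ε) ε ∧ E (x, 0) = c x := by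
  let α : ℝ → ℝ := fun x => (c x).1 + (c x).2
  let β : ℝ → ℝ := fun x => (c x).1 - (c x).2
  let Ψ : ℝ × ℝ → ℝ × ℝ := fun z =>
    ((α (z.1 + z.2) + β (z.1 - z.2)) / 2, (α (z.1 + z.2) - β (z.1 - z.2)) / 2)
  let S : Set (ℝ × ℝ) := {z | z.1 + z.2 ∈ Set.Ioo (-ε) ε ∧ z.1 - z.2 ∈ Set.Ioo (-ε) ε}
  have hS : IsOpen S := (isOpen_Ioo.preimage (continuous_fst.add continuous_snd)).inter
    (isOpen_Ioo.preimage (continuous_fst.sub continuous_snd))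
  have hα : ContDiffOn ℝ ∞ α (Set.Ioo (-ε) ε) := hc.fst.add hc.snd
  have hβ : ContDiffOn ℝ ∞ β (Set.Ioo (-ε) ε) := hc.fst.sub hc.snd
  have hΨ : ContDiffOn ℝ ∞ Ψ S := by
    have h1 : ContDiffOn ℝ ∞ (fun z : ℝ × ℝ => α (z.1 + z.2)) S :=
      hα.comp (contDiff_fst.add contDiff_snd).contDiffOn fun z hz => hz.1
    have h2 : ContDiffOn ℝ ∞ (fun z : ℝ × ℝ => β (z.1 - z.2)) S :=
      hβ.comp (contDiff_fst.sub contDiff_snd).contDiffOn fun z hz => hz.2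
    exact ((h1.add h2).div_const 2).prodMk ((h1.sub h2).div_const 2)
  have hcd : ∀ x ∈ Set.Ioo (-ε) ε, HasDerivAt c (deriv c x) x := fun x hx =>
    ((hc.contDiffAt (isOpen_Ioo.mem_nhds hx)).differentiableAt (by simp)).hasDerivAt
  have hαd : ∀ x ∈ Set.Ioo (-ε) ε, HasDerivAt α ((deriv c x).1 + (deriv c x).2) x :=
    fun x hx => by
      have h1 : HasFDerivAt α _ x := (hcd x hx).hasFDerivAt.fst.add (hcd x hx).hasFDerivAt.snd
      simpa using h1.hasDerivAt
  have hβd : ∀ x ∈ Set.Ioo (-ε) ε, HasDerivAt β ((deriv c x).1 - (deriv c x).2) x :=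
    fun x hx => by
      have h1 : HasFDerivAt β _ x := (hcd x hx).hasFDerivAt.fst.sub (hcd x hx).hasFDerivAt.snd
      simpa using h1.hasDerivAt
  -- the velocity is not null, so both null coordinates have nonvanishing derivative
  have hα0 : ∀ x ∈ Set.Ioo (-ε) ε, (deriv c x).1 + (deriv c x).2 ≠ 0 := fun x hx h =>
    h0 x hx (by linear_combination ((deriv c x).1 - (deriv c x).2) * h)
  have hβ0 : ∀ x ∈ Set.Ioo (-ε) ε, (deriv c x).1 - (deriv c x).2 ≠ 0 := fun x hx h =>
    h0 x hx (by linear_combination ((deriv c x).1 + (deriv c x).2) * h)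
  have hΨd : ∀ z (hz : z ∈ S), HasFDerivAt Ψ
      (nullScaleEquiv (hα0 _ hz.1) (hβ0 _ hz.2) : (ℝ × ℝ) →L[ℝ] (ℝ × ℝ)) z := by
    intro z hz
    have h1 := (hαd _ hz.1).comp_hasFDerivAt z
      ((hasFDerivAt_fst (𝕜 := ℝ) (p := z)).add (hasFDerivAt_snd (𝕜 := ℝ) (p := z)))
    have h2 := (hβd _ hz.2).comp_hasFDerivAt z
      ((hasFDerivAt_fst (𝕜 := ℝ) (p := z)).sub (hasFDerivAt_snd (𝕜 := ℝ) (p := z)))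
    have h3 := ((h1.add h2).mul_const (2 : ℝ)⁻¹).prodMk ((h1.sub h2).mul_const (2 : ℝ)⁻¹)
    refine h3.congr_fderiv (ContinuousLinearMap.ext fun v => ?_)
    change _ = nullScale _ _ v
    ext <;> simp [nullScale_apply] <;> ring
  have hz0 : ((0, 0) : ℝ × ℝ) ∈ S := by simp [S, hε]
  have hΨ0 : ContDiffAt ℝ ∞ Ψ (0, 0) := hΨ.contDiffAt (hS.mem_nhds hz0)
  let E₀ := hΨ0.toOpenPartialHomeomorph Ψ (hΨd _ hz0) (by simp)
  let E := E₀.restrOpen S hS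
  have hEs : ∀ z ∈ E.source, z ∈ S := fun z hz => hz.2
  have hE : ∀ z, E z = Ψ z := fun z => rfl
  have hsymm : ∀ z (hz : z ∈ E.target), HasFDerivAt E.symm
      ((nullScaleEquiv (hα0 _ (hEs _ (E.map_target hz)).1)
        (hβ0 _ (hEs _ (E.map_target hz)).2)).symm : (ℝ × ℝ) →L[ℝ] (ℝ × ℝ)) z :=
    fun z hz => E.hasFDerivAt_symm hz (hΨd _ (hEs _ (E.map_target hz)))
  refine ⟨E, ⟨hΨ0.mem_toOpenPartialHomeomorph_source (hΨd _ hz0) (by simp), hz0⟩,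
    hΨ.mono hEs, fun z hz => ?_, fun z hz v => ?_, fun x hx => ?_⟩
  · exact (E.contDiffAt_symm hz (hΨd _ (hEs _ (E.map_target hz)))
      (hΨ.contDiffAt (hS.mem_nhds (hEs _ (E.map_target hz))))).contDiffWithinAt
  · rw [(hsymm z hz).fderiv]
    exact nullScale_jMul _ _ v
  · have h1 := hEs _ hx
    refine ⟨by simpa using h1.1, ?_⟩
    rw [hE]
    simp only [Ψ, α, β, add_zero, sub_zero]
    ext <;> simp

section Coordinate

variable {M : Type*} [TopologicalSpace M] [ChartedSpace (ℝ × ℝ) M]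

/-- The velocity of the first coordinate curve of a chart. -/
theorem velocity_coordinate_curve {e : OpenPartialHomeomorph M (ℝ × ℝ)} {x : ℝ}
    (he : MDifferentiableAt 𝓘(ℝ, ℝ × ℝ) 𝓘(ℝ, ℝ × ℝ) e.symm (x, 0)) :
    velocity (fun s : ℝ => e.symm (s, 0)) x =
      mfderiv 𝓘(ℝ, ℝ × ℝ) 𝓘(ℝ, ℝ × ℝ) e.symm (x, 0) ((1, 0) : ℝ × ℝ) := by
  have h1 : HasFDerivAt (fun s : ℝ => ((s, 0) : ℝ × ℝ)) (ContinuousLinearMap.inl ℝ ℝ ℝ) x :=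
    (ContinuousLinearMap.inl ℝ ℝ ℝ).hasFDerivAt
  have h2 := (HasMFDerivAt.comp x he.hasMFDerivAt (hasMFDerivAt_iff_hasFDerivAt.2 h1)).mfderiv
  exact congrArg (fun T : ℝ →L[ℝ] ℝ × ℝ => T 1) h2

theorem velocity_congr {γ γ' : ℝ → M} {t : ℝ} (h : γ =ᶠ[𝓝 t] γ') :
    velocity γ t = velocity γ' t :=
  congrArg (fun T : ℝ →L[ℝ] ℝ × ℝ => T 1) h.mfderiv_eq

theorem velocity_comp_add_const {γ : ℝ → M} {t s : ℝ}
    (h : MDifferentiableAt 𝓘(ℝ, ℝ) 𝓘(ℝ, ℝ × ℝ) γ (s + t)) :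
    velocity (fun x => γ (x + t)) s = velocity γ (s + t) := by
  have h1 : HasFDerivAt (fun x : ℝ => x + t) (ContinuousLinearMap.id ℝ ℝ) s :=
    (hasFDerivAt_id s).add_const t
  have h2 := (HasMFDerivAt.comp s h.hasMFDerivAt (hasMFDerivAt_iff_hasFDerivAt.2 h1)).mfderiv
  exact congrArg (fun T : ℝ →L[ℝ] ℝ × ℝ => T 1) h2

/-- A regular curve whose velocity is not null is the real axis of a paraholomorphic coordinate. -/
theorem IsRegularCurve.exists_paraCoordinate [LorentzSurface M] {γ : ℝ → M} {a b : ℝ}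
    (hγ : IsRegularCurve γ a b) {t : ℝ} (ht : t ∈ Set.Ioo a b)
    (hn : (velocity γ t).1 ^ 2 ≠ (velocity γ t).2 ^ 2) :
    ∃ e : OpenPartialHomeomorph M (ℝ × ℝ), IsParaCoordinate e ∧ γ t ∈ e.source ∧
      e (γ t) = (0, 0) ∧ ∀ x : ℝ, (x, (0 : ℝ)) ∈ e.target →
        x + t ∈ Set.Ioo a b ∧ e.symm (x, 0) = γ (x + t) := by
  set φ := chartAt (ℝ × ℝ) (γ t) with hφ
  have hφa : φ ∈ atlas (ℝ × ℝ) M := chart_mem_atlas _ _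
  have hφp := isParaCoordinate_of_mem_atlas hφa
  have hφs : γ t ∈ φ.source := mem_chart_source _ _
  let c : ℝ → ℝ × ℝ := fun x => φ (γ (x + t))
  have hγt : ContMDiffAt 𝓘(ℝ, ℝ) 𝓘(ℝ, ℝ × ℝ) ∞ γ t := hγ.2.1.contMDiffAt (isOpen_Ioo.mem_nhds ht)
  have hadd : Filter.Tendsto (fun x : ℝ => x + t) (𝓝 0) (𝓝 t) := by
    have : ContinuousAt (fun x : ℝ => x + t) 0 := by fun_prop
    simpa [ContinuousAt] using this
  have hgood : ∀ᶠ x in 𝓝 (0 : ℝ), x + t ∈ Set.Ioo a b ∧ γ (x + t) ∈ φ.source :=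
    hadd.eventually ((isOpen_Ioo.eventually_mem ht).and
      (hγt.continuousAt.eventually (φ.open_source.mem_nhds hφs)))
  have hsmooth : ∀ x, x + t ∈ Set.Ioo a b ∧ γ (x + t) ∈ φ.source → ContDiffAt ℝ ∞ c x := by
    rintro x ⟨h1, h2⟩
    rw [← contMDiffAt_iff_contDiffAt]
    refine (contMDiffAt_of_mem_maximalAtlas hφp.1 h2).comp x (g := φ) ?_
    refine (hγ.2.1.contMDiffAt (isOpen_Ioo.mem_nhds h1)).comp x (g := γ) ?_
    exact (contDiff_id.add contDiff_const).contDiffAt.contMDiffAt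
  have hc0 : deriv c 0 = velocity γ t := by
    have h1 : mfderiv 𝓘(ℝ, ℝ) 𝓘(ℝ, ℝ × ℝ) γ t = fderiv ℝ (φ ∘ γ) t := by
      refine (hγ.mdifferentiableAt ht).mfderiv.trans ?_
      rw [ModelWithCorners.range_eq_univ, fderivWithin_univ]
      rfl
    have h2 : deriv c 0 = deriv (φ ∘ γ) (0 + t) := deriv_comp_add_const (φ ∘ γ) t 0
    rw [h2, zero_add]
    exact (congrArg (fun T : ℝ →L[ℝ] ℝ × ℝ => T 1) h1).symm
  obtain ⟨δ, hδ, hδg⟩ := Metric.eventually_nhds_iff_ball.1 hgood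
  have hcd : ContDiffOn ℝ ∞ c (Metric.ball 0 δ) :=
    fun x hx => (hsmooth x (hδg x hx)).contDiffWithinAt
  have hcont : ContinuousAt (deriv c) 0 :=
    (hcd.continuousOn_deriv_of_isOpen Metric.isOpen_ball (by simp)).continuousAt
      (Metric.ball_mem_nhds 0 hδ)
  have hne : ∀ᶠ x in 𝓝 (0 : ℝ), (deriv c x).1 ^ 2 - (deriv c x).2 ^ 2 ≠ 0 := by
    refine ContinuousAt.eventually_ne ?_ ?_
    · exact (hcont.fst.pow 2).sub (hcont.snd.pow 2)
    · rw [hc0]; exact sub_ne_zero.2 hn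
  -- near the given parameter the curve stays in the chart and its velocity is not null
  obtain ⟨ε, hε, hεg⟩ := Metric.eventually_nhds_iff_ball.1 (hgood.and hne)
  rw [Real.ball_eq_Ioo, zero_sub, zero_add] at hεg
  obtain ⟨E, hE0, hE, hEs, hEj, hEc⟩ := exists_paraholomorphic_extension hε
    (fun x hx => (hsmooth x (hεg x hx).1).contDiffWithinAt)
    (fun x hx => sub_ne_zero.1 (hεg x hx).2)
  have hE00 : E (0, 0) = φ (γ t) := by
    rw [(hEc 0 hE0).2]
    simp only [c, zero_add]
  refine ⟨φ.trans E.symm, ⟨?_, ?_⟩, ?_, ?_, ?_⟩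
  · refine OpenPartialHomeomorph.mem_maximalAtlas_of_contMDiffOn _ ?_ ?_
    · refine (contMDiffOn_iff_contDiffOn.2 hEs).comp
        ((contMDiffOn_of_mem_maximalAtlas hφp.1).mono fun x hx => hx.1) fun x hx => ?_
      exact hx.2
    · refine (contMDiffOn_symm_of_mem_maximalAtlas hφp.1).comp
        ((contMDiffOn_iff_contDiffOn.2 hE).mono fun x hx => hx.1) fun x hx => ?_
      exact hx.2
  · intro e' he' x hx v
    have hx1 : x ∈ (e'.symm.trans φ).source := ⟨hx.1, hx.2.1⟩
    have hx2 : (e'.symm.trans φ) x ∈ E.target := hx.2.2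
    have h1 : DifferentiableAt ℝ E.symm ((e'.symm.trans φ) x) :=
      (hEs.contDiffAt (E.open_target.mem_nhds hx2)).differentiableAt (by simp)
    have h2 : DifferentiableAt ℝ (e'.symm.trans φ) x := by
      rw [← mdifferentiableAt_iff_differentiableAt]
      exact (mdifferentiableAt_atlas hφa hx.2.1).comp x (mdifferentiableAt_atlas_symm he' hx.1)
    have h3 : fderiv ℝ (e'.symm.trans (φ.trans E.symm)) x =
        (fderiv ℝ E.symm ((e'.symm.trans φ) x)).comp (fderiv ℝ (e'.symm.trans φ) x) :=
      fderiv_comp x h1 h2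
    rw [h3, ContinuousLinearMap.comp_apply, ContinuousLinearMap.comp_apply,
      hφp.2 e' he' x hx1, hEj _ hx2]
  · refine ⟨hφs, ?_⟩
    change φ (γ t) ∈ E.target
    rw [← hE00]
    exact E.map_source hE0
  · change E.symm (φ (γ t)) = _
    rw [← hE00, E.left_inv hE0]
  · intro x hx
    have hx1 := hEc x hx.1
    have hx2 := (hεg x hx1.1).1
    refine ⟨hx2.1, ?_⟩
    change φ.symm (E (x, 0)) = _
    rw [hx1.2]
    exact φ.left_inv hx2.2

variable [LorentzSurface M]

/-- In a paraholomorphic coordinate the derivatives of a map along the real axis and across it are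
its differentials at the velocity `w` of the axis and at `j w`. -/
theorem IsParaCoordinate.fderiv_axis {e : OpenPartialHomeomorph M (ℝ × ℝ)} (he : IsParaCoordinate e)
    {x : ℝ} (hx : (x, (0 : ℝ)) ∈ e.target) {F : M → R31}
    (hF : MDifferentiable 𝓘(ℝ, ℝ × ℝ) 𝓘(ℝ, R31) F) :
    fderiv ℝ (F ∘ e.symm) (x, 0) (1, 0) =
      dSurf F (e.symm (x, 0)) (velocity (fun s : ℝ => e.symm (s, 0)) x) ∧
    fderiv ℝ (F ∘ e.symm) (x, 0) (0, 1) =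
      dSurf F (e.symm (x, 0)) (jMul (velocity (fun s : ℝ => e.symm (s, 0)) x)) ∧
    velocity (fun s : ℝ => e.symm (s, 0)) x ≠ 0 := by
  obtain ⟨L, hL, hLj, hLF⟩ := he.exists_equiv (e.map_target hx)
  rw [e.right_inv hx] at hL hLF
  have hv : velocity (fun s : ℝ => e.symm (s, 0)) x = L (1, 0) := by
    rw [velocity_coordinate_curve
      (mdifferentiableAt_symm_of_mem_maximalAtlas he.mem_one hx)]
    exact congrArg (fun T : (ℝ × ℝ) →L[ℝ] (ℝ × ℝ) => T (1, 0)) hL.symm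
  rw [hv, ← hLj, hLF F (hF _), hLF F (hF _)]
  exact ⟨rfl, rfl, by simp⟩

variable [PreconnectedSpace M] {f G : M → R31}

/-- The folded symmetry of the conjugate of the dual surface, whose last two components are
conjugate to those of `f`. -/
theorem hasFoldedSymmetry_iff_hasAxisCurve (hf : ContMDiff 𝓘(ℝ, ℝ × ℝ) 𝓘(ℝ, R31) ∞ f)
    (hc : IsConformal f) (hG : IsPartialConjugate ![false, true, true] f G) :
    HasFoldedSymmetry G ↔ HasAxisCurve f := by
  have hfd : MDifferentiable 𝓘(ℝ, ℝ × ℝ) 𝓘(ℝ, R31) f := hf.mdifferentiable (by simp)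
  have hd0 : ∀ p v, dSurf G p v 0 = dSurf f p v 0 := fun p v => by simp [hG.dSurf_apply]
  have hd1 : ∀ p v, dSurf G p (jMul v) 1 = dSurf f p v 1 := fun p v => by
    simp [hG.dSurf_apply]
  have hd2 : ∀ p v, dSurf G p (jMul v) 2 = dSurf f p v 2 := fun p v => by
    simp [hG.dSurf_apply]
  have hone : (1 : Matrix (Fin 3) (Fin 3) ℝ) = Matrix.diagonal ![1, 1, 1] := by
    ext i k; fin_cases i <;> fin_cases k <;> simp
  have hGc := hG.isConformal hc
  constructor
  · rintro ⟨g, e, p, hs, ⟨he, hp, hep, hpl, hfold⟩, hfix⟩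
    rw [hone] at hs
    have h00 : ((0 : ℝ), (0 : ℝ)) ∈ e.target := hep ▸ e.map_source hp
    have hps : e.symm (0, 0) = p := by rw [← hep, e.left_inv hp]
    -- the derivative along the axis does not vanish at the folding singularity, nor nearby
    have hne0 : fderiv ℝ (G ∘ e.symm) (0, 0) (1, 0) ≠ 0 := by
      intro h0
      obtain ⟨L, -, -, hL⟩ := he.exists_equiv hp
      have hL := hL G (hG.mdifferentiable p)
      rw [hep] at hL
      refine ne_zero_of_mem_lightlikeSet hpl (ContinuousLinearMap.ext fun v => ?_)
      have h1 := hL (L.symm v)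
      rw [L.apply_symm_apply] at h1
      have h2 : L.symm v = (L.symm v).1 • (1, 0) + (L.symm v).2 • (0, 1) := by simp
      rw [← h1, h2, map_add, map_smul, map_smul, h0, hfold 0 h00]
      simp
    have hcont : ContinuousAt (fun x : ℝ => fderiv ℝ (G ∘ e.symm) (x, 0) (1, 0)) 0 := by
      have h1 : ContinuousAt (fderiv ℝ (G ∘ e.symm)) ((0 : ℝ), (0 : ℝ)) :=
        ((he.contDiffOn hG.smooth).continuousOn_fderiv_of_isOpen e.open_target
          (by simp)).continuousAt (e.open_target.mem_nhds h00)
      have h2 : ContinuousAt (fun x : ℝ => ((x, 0) : ℝ × ℝ)) 0 := by fun_prop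
      exact (ContinuousAt.comp (f := fun x : ℝ => ((x, 0) : ℝ × ℝ)) h1 h2).clm_apply
        continuousAt_const
    have htar : ∀ᶠ x : ℝ in 𝓝 0, (x, (0 : ℝ)) ∈ e.target := by
      have h2 : ContinuousAt (fun x : ℝ => ((x, 0) : ℝ × ℝ)) 0 := by fun_prop
      exact h2.eventually (e.open_target.mem_nhds h00)
    obtain ⟨δ, hδ, hδg⟩ := Metric.eventually_nhds_iff_ball.1 (htar.and (hcont.eventually_ne hne0))
    rw [Real.ball_eq_Ioo, zero_sub, zero_add] at hδg
    have hγ : IsRegularCurve (fun x : ℝ => e.symm (x, 0)) (-δ) δ := by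
      refine ⟨by linarith, ?_, fun t ht => (he.fderiv_axis (hδg t ht).1 hG.mdifferentiable).2.2⟩
      refine (contMDiffOn_symm_of_mem_maximalAtlas he.1).comp (t := e.target) ?_
        fun x hx => (hδg x hx).1
      exact (contDiff_id.prodMk contDiff_const).contMDiff.contMDiffOn
    refine ⟨_, g, _, -δ, δ, (hG.symm hf).isReversingSymmetry hG.mdifferentiable hs
      (by intro i; fin_cases i <;> simp) (by intro i; fin_cases i <;> simp)
      (hfix 0 h00), hγ, fun x hx => hfix x (hδg x hx).1, fun x hx => ?_⟩
    obtain ⟨hx1, hx2⟩ := hδg x hx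
    obtain ⟨ha, hb, -⟩ := he.fderiv_axis hx1 hG.mdifferentiable
    rw [hfold x hx1] at hb
    rw [← hd0, ← hd1, ← hd2, ← hb]
    refine ⟨rfl, rfl, fun h0 => hx2 ?_⟩
    rw [ha]
    refine eq_zero_of_lorentzForm_self h0 ?_
    have h1 := hGc.self_jMul (e.symm (x, 0)) (velocity (fun s : ℝ => e.symm (s, 0)) x)
    rw [← hb] at h1
    simp only [lorentzForm, Pi.zero_apply] at h1 ⊢
    linarith
  · rintro ⟨t, g, γ, a, b, hs, hγ, hfix, h⟩
    have hm := hγ.mid_mem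
    have hs' := hG.isReversingSymmetry (o' := ![1, 1, 1]) hfd hs
      (by intro i; fin_cases i <;> simp) (by intro i; fin_cases i <;> simp) (hfix _ hm)
    have hz : ∀ t ∈ Set.Ioo a b, dSurf G (γ t) (jMul (velocity γ t)) = 0 := by
      intro t ht
      funext i
      fin_cases i
      · exact (hd0 _ _).trans (hc.jMul_apply_zero (h t ht).1 (h t ht).2.1 (h t ht).2.2)
      · exact (hd1 _ _).trans (h t ht).1
      · exact (hd2 _ _).trans (h t ht).2.1
    obtain ⟨e, he, hes, he0, hex⟩ := hγ.exists_paraCoordinate hm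
      (velocity_sq_ne_sq hγ hs.reversing hfix hm)
    refine ⟨g, e, γ ((a + b) / 2), ?_, ⟨he, hes, he0, ?_, fun x hx => ?_⟩, fun x hx => ?_⟩
    · rw [hone]
      convert hs' using 1
      rw [← hone, Matrix.one_mulVec, sub_self]
    · refine hGc.mem_lightlikeSet (u := velocity γ ((a + b) / 2)) ?_ (hz _ hm) fun h0 => ?_
      · intro h0
        have h1 := congrArg jMul h0
        rw [jMul_jMul, map_zero] at h1
        exact hγ.2.2 _ hm h1
      · have h1 := congrFun h0 0
        rw [hd0] at h1
        exact (h _ hm).2.2 h1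
    · have hev : (fun s : ℝ => e.symm (s, 0)) =ᶠ[𝓝 x] fun s => γ (s + (a + b) / 2) := by
        have h2 : ContinuousAt (fun x : ℝ => ((x, 0) : ℝ × ℝ)) x := by fun_prop
        filter_upwards [h2.eventually (e.open_target.mem_nhds hx)] with s hs using (hex s hs).2
      rw [(he.fderiv_axis hx hG.mdifferentiable).2.1, velocity_congr hev,
        velocity_comp_add_const (hγ.mdifferentiableAt (hex x hx).1), (hex x hx).2]
      exact hz _ (hex x hx).1
    · rw [(hex x hx).2]
      exact hfix _ (hex x hx).1

end Coordinate

end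

theorem mainTheorem6 {M : Type*} [TopologicalSpace M] [T2Space M] [SecondCountableTopology M]
    [ChartedSpace (ℝ × ℝ) M] [LorentzSurface M] [SimplyConnectedSpace M]
    (f : M → R31) (hf : IsTimelikeMinimal f) :
    (∃ Φ : M → Fin 3 → ParaC, IsParaholomorphicLift f Φ) ∧
    ∀ Φ : M → Fin 3 → ParaC, IsParaholomorphicLift f Φ → ∀ c₁ c₂ c₃ : R31,
      [HasLineSymmetry f,
       HasPlanarSymmetry (goursat matJ Φ c₁),
       HasPointSymmetry (goursat matD Φ c₂),
       HasFoldedSymmetry (goursat (matJ * matD) Φ c₃)].TFAE := by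
  refine ⟨hf.exists_lift, fun Φ hΦ c₁ c₂ c₃ => ?_⟩
  have h1 := hasLineSymmetry_iff_hasAxisCurve hf.smooth
  have h2 := hasPlanarSymmetry_iff_hasAxisCurve hf.smooth hf.conformal
    (isPartialConjugate_goursat hΦ (a := ![paraUnit, paraUnit, paraUnit]) (σ := fun _ => true)
      (by intro i; fin_cases i <;> rfl) c₁)
  have h3 := hasPointSymmetry_iff_hasAxisCurve hf.smooth hf.conformal
    (isPartialConjugate_goursat hΦ (a := ![paraUnit, 1, 1])
      (by intro i; fin_cases i <;> rfl) c₂)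
  have hJD : matJ * matD = Matrix.diagonal ![1, paraUnit, paraUnit] := by
    rw [matJ, matD, Matrix.diagonal_mul_diagonal]
    congr 1
    funext i
    fin_cases i <;> simp [paraUnit_mul_self]
  have h4 := hasFoldedSymmetry_iff_hasAxisCurve hf.smooth hf.conformal
    (isPartialConjugate_goursat hΦ (a := ![1, paraUnit, paraUnit])
      (by intro i; fin_cases i <;> rfl) c₃)
  rw [← hJD] at h4
  rw [← matJ] at h2
  rw [← matD] at h3
  tfae_have 1 ↔ 2 := h1.trans h2.symm
  tfae_have 1 ↔ 3 := h1.trans h3.symm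
  tfae_have 1 ↔ 4 := h1.trans h4.symm
  tfae_finish
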